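/- Throughout, $\log$ denotes the logarithm to base $2$, and graphs are finite and simple. For a graph $H$ and an integer $t\ge 0$, the blowup $H[t]$ is the graph obtained from $H$ by replacing every vertex by an independent set of order $t$ and every edge by a complete bipartite graph between the two corresponding sets. A copy of $H$ in $G$ is a (not necessarily induced) subgraph of $G$ isomorphic to $H$. For an $h$-vertex graph $H$ and $\gamma>0$, let $c_H(\gamma)\in[0,\infty]$ be the supremum of all real $c>0$ with the following property: there is a sequence $\varepsilon_N\to 0$ (as $N\to\infty$) such that, for every $N$, every $N$-vertex graph with at least $\gamma N^h$ copies of $H$ contains $H[t]$ as a subgraph for some integer $t\ge (c-\varepsilon_N)\log N$. (The supremum is $0$ if there is no such $c$, and $\infty$ if the set of such $c$ is unbounded.) **Theorem.** For every integer $k\ge 3$ there is a constant $\delta_k>0$, depending only on $k$, such that for all $0<\gamma<1$, $$c_{K_{k+1}}(\gamma)\ \ge\ \min\left\{\delta_k\,\frac{\gamma^{2/(k+1)}}{\log\frac1\gamma},\ \frac18\,c_{K_k}\!\left(\frac{\gamma}{8k^k}\right)\right\}.$$ -/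

import Mathlib

open Filter Topology
open scoped ENNReal

/-- The `t`-blowup `H[t]`: every vertex of `H` is replaced by an independent set of order `t`, and
every edge by a complete bipartite graph between the two corresponding independent sets. -/
def graphBlowup {V : Type*} (H : SimpleGraph V) (t : ℕ) : SimpleGraph (V × Fin t) where
  Adj x y := H.Adj x.1 y.1
  symm := ⟨fun _ _ h => h.symm⟩
  loopless := ⟨fun _ h => h.ne rfl⟩

/-- With `h` the number of vertices of `H`: every `N`-vertex graph with at least `γ N ^ h`
(unlabelled, not necessarily induced) copies of `H` contains a blowup `H[t]` as a subgraph, for some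
`t ≥ (c - o(1)) log₂ N`, where the `o(1)` term depends only on `N` (for fixed `H`, `γ`, `c`) and
tends to `0` as `N → ∞`. -/
def ForcesBlowup {V : Type*} [Fintype V] (H : SimpleGraph V) (γ c : ℝ) : Prop :=
  ∃ ε : ℕ → ℝ, Tendsto ε atTop (𝓝 0) ∧
    ∀ (N : ℕ) (G : SimpleGraph (Fin N)),
      γ * (N : ℝ) ^ Fintype.card V ≤ (G.copyCount H : ℝ) →
        ∃ t : ℕ, (c - ε N) * Real.logb 2 N ≤ t ∧ (graphBlowup H t).IsContained G

/-- The optimal constant `c_H(γ)`: the supremum of all `c > 0` such that every `N`-vertex graph with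
at least `γ N ^ h` copies of `H` contains an `H`-blowup of size `(c - o(1)) log₂ N`. The supremum is
taken in `[0, ∞]`; it is `∞` when `γ` is so large that no nonempty graph has that many copies. -/
noncomputable def blowupConst {V : Type*} [Fintype V] (H : SimpleGraph V) (γ : ℝ) : ℝ≥0∞ :=
  ⨆ (c : ℝ) (_ : 0 < c ∧ ForcesBlowup H γ c), ENNReal.ofReal c

/-! Put n = k + 1 and count cliques as ordered tuples in boxes A_1 × ... × A_n of vertex sets. The
aim is a set T of order log N vertices, chosen from one part i, that is complete to all other parts
of a large box of clique density at least γ/2. Dropping part i leaves a k-partite graph with many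
copies of K_k; a blowup of K_k found there, together with T, is a blowup of K_{k+1}.

T comes from a potential argument (`exists_completeState`). Among states with chosen sets T_i
complete to A_j for j ≠ i, maximise α Σ|T_i| + log vol A − b / dens A. Maximality makes A robust: no
large subbox is much denser than A, and since complementary subboxes partition A, no large subbox is
much sparser either (`le_cliqueDens_of_maximal`). Suppose some vertex of A has relative degrees to
the other parts with product of order γ^(2/n). Moving to its neighbourhoods costs O(γ^(-2/n)
log(1/γ)) of potential, which is less than α (`exists_step`). So about (log N)/α vertices get
chosen, and this is the first term of the minimum.

The vertex is supplied by `exists_vertex_prod_relDegree`. If all large subboxes have clique density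
at least y, then the product of the edge densities between parts is at least a constant times y
(`exists_prod_edgeDens_lower`): a subbox nearly minimising this product is upper regular up to a
factor 2, so a one-sided counting lemma applies. Multiplying relative degrees over all ordered pairs
of parts counts each pair twice and gives about y^2, so one of the n parts contributes about
y^(2/n). The size threshold ρ depends on γ, but it only affects how large N must be, not δ. -/

/-! ### Boxes, resampling, cells, and edge and clique densities. -/

section BoxDensity
open scoped Classical
open Finset Fintype

variable {ι V : Type*} [Fintype ι]

/-- The volume of a box. -/
noncomputable def boxVol (A : ι → Finset V) : ℝ := ∏ i, (#(A i) : ℝ)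

theorem boxVol_pos {A : ι → Finset V} (hA : ∀ i, (A i).Nonempty) : 0 < boxVol A :=
  Finset.prod_pos fun i _ => by exact_mod_cast (hA i).card_pos

theorem boxVol_nonneg (A : ι → Finset V) : 0 ≤ boxVol A :=
  Finset.prod_nonneg fun i _ => by positivity

variable [DecidableEq ι]

/-- Resampling one coordinate of a uniformly random point of a box. -/
theorem sum_piFinset_resample_subset (A : ι → Finset V) (i : ι) (S : Finset V)
    (f : (ι → V) → ℝ) :
    ∑ w ∈ piFinset A, ∑ x ∈ S, f (Function.update w i x) =
      (#(A i) : ℝ) * ∑ w ∈ piFinset (Function.update A i S), f w := by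
  have h1 : ∑ w ∈ piFinset A, ∑ x ∈ S, f (Function.update w i x) =
      ∑ w ∈ piFinset (Function.update A i S), ∑ _x ∈ A i, f w := by
    rw [← Finset.sum_product', ← Finset.sum_product']
    refine Finset.sum_nbij' (fun p => (Function.update p.1 i p.2, p.1 i))
      (fun p => (Function.update p.1 i p.2, p.1 i)) ?_ ?_ ?_ ?_ ?_
    · rintro ⟨w, x⟩ h
      simp only [mem_product, mem_piFinset] at h ⊢
      refine ⟨fun j => ?_, h.1 i⟩
      by_cases hj : j = i
      · subst hj; simpa using h.2
      · simpa [hj] using h.1 j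
    · rintro ⟨w, x⟩ h
      simp only [mem_product, mem_piFinset] at h ⊢
      refine ⟨fun j => ?_, by simpa using h.1 i⟩
      by_cases hj : j = i
      · subst hj; simpa using h.2
      · simpa [hj] using h.1 j
    · rintro ⟨w, x⟩ _; simp
    · rintro ⟨w, x⟩ _; simp
    · rintro ⟨w, x⟩ _; simp
  rw [h1, Finset.mul_sum]
  simp

theorem sum_piFinset_resample (A : ι → Finset V) (i : ι) (f : (ι → V) → ℝ) :
    ∑ w ∈ piFinset A, ∑ x ∈ A i, f (Function.update w i x) =
      (#(A i) : ℝ) * ∑ w ∈ piFinset A, f w := by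
  rw [sum_piFinset_resample_subset, Function.update_eq_self]

theorem card_piFinset_eq_boxVol (A : ι → Finset V) : (#(piFinset A) : ℝ) = boxVol A := by
  simp [boxVol, Fintype.card_piFinset]

theorem sum_piFinset_resample_two (A : ι → Finset V) {i j : ι} (f : (ι → V) → ℝ) :
    ∑ w ∈ piFinset A, ∑ x ∈ A i, ∑ z ∈ A j, f (Function.update (Function.update w i x) j z) =
      (#(A i) : ℝ) * #(A j) * ∑ w ∈ piFinset A, f w := by
  rw [sum_piFinset_resample A i (fun w => ∑ z ∈ A j, f (Function.update w j z)),
    sum_piFinset_resample A j]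
  ring

theorem sum_piFinset_pair (A : ι → Finset V) {i j : ι} (hij : i ≠ j) (g : V → V → ℝ) :
    (#(A i) : ℝ) * #(A j) * ∑ w ∈ piFinset A, g (w i) (w j) =
      boxVol A * ∑ x ∈ A i, ∑ z ∈ A j, g x z := by
  rw [← sum_piFinset_resample_two A (fun w => g (w i) (w j)), ← card_piFinset_eq_boxVol]
  simp [Function.update_of_ne hij]

/-- A finite set has a subset of any smaller size on which a function has at most its average. -/
theorem exists_subset_card_eq_sum_le (S : Finset V) (f : V → ℝ) {m : ℕ} (hm : 1 ≤ m)
    (hmS : m ≤ #S) : ∃ S' ⊆ S, #S' = m ∧ (#S : ℝ) * ∑ x ∈ S', f x ≤ m * ∑ x ∈ S, f x := by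
  obtain ⟨d, hd⟩ := Nat.exists_eq_add_of_le hmS
  induction d generalizing S with
  | zero => exact ⟨S, Subset.rfl, by omega, by rw [hd]; simp⟩
  | succ d ih =>
    have hne : S.Nonempty := card_pos.1 (by omega)
    obtain ⟨x, hx, hmax⟩ := S.exists_max_image f hne
    have hc : #(S.erase x) = #S - 1 := card_erase_of_mem hx
    obtain ⟨S', hS', hcard, hle⟩ := ih (S.erase x) (by omega) (by omega)
    refine ⟨S', hS'.trans (erase_subset _ _), hcard, ?_⟩
    have hsum : ∑ u ∈ S.erase x, f u = ∑ u ∈ S, f u - f x := by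
      rw [← Finset.add_sum_erase S f hx]; ring
    have hub : ∑ u ∈ S, f u ≤ #S * f x := by
      have := Finset.sum_le_card_nsmul S f (f x) hmax
      simpa using this
    have hc' : (#(S.erase x) : ℝ) = #S - 1 := by rw [hc]; push_cast [hne.card_pos]; ring
    rw [hc', hsum] at hle
    have h1 : (1 : ℝ) ≤ m := by exact_mod_cast hm
    have h2 : (m : ℝ) + 1 ≤ #S := by rw [hd]; push_cast; linarith [Nat.cast_nonneg (α := ℝ) d]
    set s : ℝ := (#S : ℝ)
    have hs : 0 < s - 1 := by linarith
    have : (s - 1) * (s * ∑ x ∈ S', f x) ≤ (s - 1) * (m * ∑ x ∈ S, f x) := by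
      nlinarith [mul_le_mul_of_nonneg_left hle (show 0 ≤ s by linarith),
        mul_le_mul_of_nonneg_left hub (show (0 : ℝ) ≤ m by linarith)]
    exact le_of_mul_le_mul_left this hs

theorem exists_subset_card_eq_le_sum (S : Finset V) (f : V → ℝ) {m : ℕ} (hm : 1 ≤ m)
    (hmS : m ≤ #S) : ∃ S' ⊆ S, #S' = m ∧ m * ∑ x ∈ S, f x ≤ (#S : ℝ) * ∑ x ∈ S', f x := by
  obtain ⟨S', h1, h2, h3⟩ := exists_subset_card_eq_sum_le S (fun x => -f x) hm hmS
  refine ⟨S', h1, h2, ?_⟩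
  simp only [sum_neg_distrib] at h3
  linarith

/-- The part of `B` on which `f` takes the value `f x`. -/
noncomputable def fiberCell {κ : Type*} (f : V → κ) (B : Finset V) (x : V) : Finset V :=
  B.filter fun u => f u = f x

theorem mem_fiberCell {κ : Type*} {f : V → κ} {B : Finset V} {x u : V} :
    u ∈ fiberCell f B x ↔ u ∈ B ∧ f u = f x := by
  rw [fiberCell, mem_filter]

theorem fiberCell_subset {κ : Type*} (f : V → κ) (B : Finset V) (x : V) : fiberCell f B x ⊆ B :=
  filter_subset _ _

/-- A cell C is hit by exactly |C| points `x`, each contributing the average of `F` over C, so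
passing to cell averages preserves the sum. -/
theorem sum_fiberCell_average {κ : Type*} (f : V → κ) (B : Finset V) (F : V → ℝ) :
    ∑ x ∈ B, (∑ u ∈ fiberCell f B x, F u) / #(fiberCell f B x) = ∑ u ∈ B, F u := by
  have h : ∀ x ∈ B, (∑ u ∈ fiberCell f B x, F u) / #(fiberCell f B x) =
      ∑ u ∈ B, if f u = f x then F u / #(fiberCell f B u) else 0 := by
    intro x _
    rw [← Finset.sum_filter, Finset.sum_div]
    refine Finset.sum_congr rfl fun u hu => ?_
    have : fiberCell f B x = fiberCell f B u := by
      simp only [fiberCell, mem_filter] at hu ⊢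
      rw [hu.2]
    rw [this]
  rw [Finset.sum_congr rfl h, Finset.sum_comm]
  refine Finset.sum_congr rfl fun u hu => ?_
  have h2 : ∑ x ∈ B, (if f u = f x then F u / #(fiberCell f B u) else 0) =
      ∑ x ∈ fiberCell f B u, F u / #(fiberCell f B u) := by
    rw [fiberCell, Finset.sum_filter]
    exact Finset.sum_congr rfl fun x _ => by simp only [eq_comm]
  rw [h2, Finset.sum_const, nsmul_eq_mul]
  have : (#(fiberCell f B u) : ℝ) ≠ 0 := by
    have : u ∈ fiberCell f B u := by simp [fiberCell, hu]
    exact_mod_cast (card_pos.2 ⟨u, this⟩).ne'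
  field_simp

variable (G : SimpleGraph V)

/-- The number of pairs in `X × Y` that are edges. -/
noncomputable def edgeSum (X Y : Finset V) : ℝ := ∑ x ∈ X, ∑ z ∈ Y, if G.Adj x z then 1 else 0

/-- The proportion of pairs in `X × Y` that are edges. -/
noncomputable def edgeDens (X Y : Finset V) : ℝ := edgeSum G X Y / (#X * #Y)

theorem edgeSum_comm (X Y : Finset V) : edgeSum G X Y = edgeSum G Y X := by
  rw [edgeSum, Finset.sum_comm, edgeSum]
  simp only [G.adj_comm]

theorem edgeDens_comm (X Y : Finset V) : edgeDens G X Y = edgeDens G Y X := by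
  rw [edgeDens, edgeSum_comm, mul_comm, edgeDens]

theorem edgeSum_nonneg (X Y : Finset V) : 0 ≤ edgeSum G X Y :=
  Finset.sum_nonneg fun _ _ => Finset.sum_nonneg fun _ _ => by split_ifs <;> norm_num

theorem edgeDens_nonneg (X Y : Finset V) : 0 ≤ edgeDens G X Y :=
  div_nonneg (edgeSum_nonneg G X Y) (by positivity)

theorem edgeSum_le (X Y : Finset V) : edgeSum G X Y ≤ #X * #Y := by
  calc edgeSum G X Y ≤ ∑ x ∈ X, ∑ z ∈ Y, (1 : ℝ) :=
        Finset.sum_le_sum fun _ _ => Finset.sum_le_sum fun _ _ => by split_ifs <;> norm_num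
    _ = _ := by simp

theorem edgeDens_le_one (X Y : Finset V) : edgeDens G X Y ≤ 1 :=
  div_le_one_of_le₀ (edgeSum_le G X Y) (by positivity)

theorem edgeSum_mono {X X' Y Y' : Finset V} (hX : X ⊆ X') (hY : Y ⊆ Y') :
    edgeSum G X Y ≤ edgeSum G X' Y' := by
  calc edgeSum G X Y ≤ ∑ x ∈ X, ∑ z ∈ Y', (if G.Adj x z then (1 : ℝ) else 0) :=
        Finset.sum_le_sum fun x _ => Finset.sum_le_sum_of_subset_of_nonneg hY fun _ _ _ => by
          split_ifs <;> norm_num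
    _ ≤ _ := Finset.sum_le_sum_of_subset_of_nonneg hX fun _ _ _ =>
        Finset.sum_nonneg fun _ _ => by split_ifs <;> norm_num

theorem edgeSum_eq_edgeDens_mul (X Y : Finset V) :
    edgeSum G X Y = edgeDens G X Y * (#X * #Y) := by
  by_cases h : (#X * #Y : ℝ) = 0
  · have := edgeSum_le G X Y
    rw [h] at this ⊢
    linarith [edgeSum_nonneg G X Y]
  · rw [edgeDens, div_mul_cancel₀ _ h]

theorem sum_edgeDens_fiberCell {κ : Type*} (f : V → κ) (X Y : Finset V) :
    ∑ z ∈ Y, edgeDens G X (fiberCell f Y z) = #Y * edgeDens G X Y := by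
  have h : ∀ z, edgeDens G X (fiberCell f Y z) =
      (∑ u ∈ fiberCell f Y z, (∑ x ∈ X, if G.Adj x u then (1 : ℝ) else 0) / #X) /
        #(fiberCell f Y z) := by
    intro z
    rw [← Finset.sum_div, div_div, edgeDens, edgeSum, Finset.sum_comm]
  simp only [h]
  rw [sum_fiberCell_average, ← Finset.sum_div, Finset.sum_comm]
  by_cases hY : (#Y : ℝ) = 0
  · have : Y = ∅ := by simpa using hY
    simp [this]
  · change edgeSum G X Y / _ = _ * (edgeSum G X Y / _)
    by_cases hX : (#X : ℝ) = 0
    · simp [hX]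
    · field_simp

theorem sum_sum_edgeDens_fiberCell {κ κ' : Type*} (f : V → κ) (f' : V → κ') (X Y : Finset V) :
    ∑ x ∈ X, ∑ z ∈ Y, edgeDens G (fiberCell f X x) (fiberCell f' Y z) = edgeSum G X Y := by
  simp only [sum_edgeDens_fiberCell, ← Finset.mul_sum]
  simp only [edgeDens_comm G _ Y, sum_edgeDens_fiberCell]
  rw [edgeSum_comm, edgeSum_eq_edgeDens_mul]
  ring

/-- The tuples spanning a clique. -/
def IsCliqueTuple (w : ι → V) : Prop := ∀ i j, i ≠ j → G.Adj (w i) (w j)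

/-- The number of clique tuples in a box. -/
noncomputable def cliqueSum (A : ι → Finset V) : ℝ :=
  ∑ w ∈ piFinset A, if IsCliqueTuple G w then 1 else 0

/-- The proportion of clique tuples in a box. -/
noncomputable def cliqueDens (A : ι → Finset V) : ℝ := cliqueSum G A / boxVol A

theorem cliqueSum_nonneg (A : ι → Finset V) : 0 ≤ cliqueSum G A :=
  Finset.sum_nonneg fun _ _ => by split_ifs <;> norm_num

theorem cliqueSum_le_boxVol (A : ι → Finset V) : cliqueSum G A ≤ boxVol A := by
  rw [← card_piFinset_eq_boxVol]
  calc cliqueSum G A ≤ ∑ w ∈ piFinset A, (1 : ℝ) :=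
        Finset.sum_le_sum fun _ _ => by split_ifs <;> norm_num
    _ = _ := by simp

theorem cliqueDens_le_one (A : ι → Finset V) : cliqueDens G A ≤ 1 :=
  div_le_one_of_le₀ (cliqueSum_le_boxVol G A) (boxVol_nonneg A)

theorem cliqueDens_le_edgeDens (A : ι → Finset V) (hA : ∀ i, (A i).Nonempty) {i j : ι}
    (hij : i ≠ j) : cliqueDens G A ≤ edgeDens G (A i) (A j) := by
  have hi : (0 : ℝ) < #(A i) := by exact_mod_cast (hA i).card_pos
  have hj : (0 : ℝ) < #(A j) := by exact_mod_cast (hA j).card_pos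
  have h := sum_piFinset_pair A hij (fun x z => if G.Adj x z then (1 : ℝ) else 0)
  have h2 : cliqueSum G A ≤ ∑ w ∈ piFinset A, if G.Adj (w i) (w j) then (1 : ℝ) else 0 := by
    refine Finset.sum_le_sum fun w _ => ?_
    by_cases hw : IsCliqueTuple G w
    · simp [hw, hw i j hij]
    · rw [if_neg hw]; split_ifs <;> norm_num
  change _ = _ * edgeSum G (A i) (A j) at h
  rw [cliqueDens, edgeDens, div_le_div_iff₀ (boxVol_pos hA) (by positivity)]
  nlinarith [mul_le_mul_of_nonneg_left h2 (mul_pos hi hj).le]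

end BoxDensity

/-! ### One-sided counting lemma for cliques. -/

section Counting
open scoped Classical
open Finset Fintype

variable {ι V : Type*} [Fintype ι] [DecidableEq ι] (G : SimpleGraph V)

/-- Freeze all coordinates but `i` and `j`. Since `S` does not constrain this pair, each constraint
in `S` involves at most one free coordinate, so together they cut out a product `X × Y`, to which
`hU` applies. Resampling the two coordinates then averages over the frozen ones. -/
theorem sum_adj_forall_le (B : ι → Finset V) (hB : ∀ i, (B i).Nonempty) (S : Finset (ι × ι))
    {i j : ι} (hij : i ≠ j) (h1 : (i, j) ∉ S) (h2 : (j, i) ∉ S) (hS : ∀ e ∈ S, e.1 ≠ e.2)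
    {D r : ℝ} (hU : ∀ X ⊆ B i, ∀ Y ⊆ B j,
      edgeSum G X Y ≤ D * (#X * #Y) + r * (#(B i) * #(B j))) :
    ∑ w ∈ piFinset B, (if G.Adj (w i) (w j) ∧ ∀ e ∈ S, G.Adj (w e.1) (w e.2) then (1 : ℝ) else 0)
      ≤ D * ∑ w ∈ piFinset B, (if ∀ e ∈ S, G.Adj (w e.1) (w e.2) then (1 : ℝ) else 0)
        + r * boxVol B := by
  have hi : (0 : ℝ) < #(B i) := by exact_mod_cast (hB i).card_pos
  have hj : (0 : ℝ) < #(B j) := by exact_mod_cast (hB j).card_pos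
  have key : ∀ w : ι → V,
      ∑ x ∈ B i, ∑ z ∈ B j,
        (if G.Adj (Function.update (Function.update w i x) j z i)
            (Function.update (Function.update w i x) j z j) ∧
          ∀ e ∈ S, G.Adj (Function.update (Function.update w i x) j z e.1)
            (Function.update (Function.update w i x) j z e.2) then (1 : ℝ) else 0) ≤
      D * (∑ x ∈ B i, ∑ z ∈ B j,
        (if ∀ e ∈ S, G.Adj (Function.update (Function.update w i x) j z e.1)
            (Function.update (Function.update w i x) j z e.2) then (1 : ℝ) else 0)) +
        r * (#(B i) * #(B j)) := by
    intro w
    -- Constraints avoiding `j` go into `X`; those involving `j` do not involve `i` and go into `Y`.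
    set X := (B i).filter fun x => ∀ e ∈ S, e.1 ≠ j → e.2 ≠ j →
      G.Adj (Function.update w i x e.1) (Function.update w i x e.2) with hX
    set Y := (B j).filter fun z => ∀ e ∈ S, (e.1 = j ∨ e.2 = j) →
      G.Adj (Function.update w j z e.1) (Function.update w j z e.2) with hY
    have hiff : ∀ x ∈ B i, ∀ z ∈ B j,
        ((∀ e ∈ S, G.Adj (Function.update (Function.update w i x) j z e.1)
          (Function.update (Function.update w i x) j z e.2)) ↔ x ∈ X ∧ z ∈ Y) := by
      intro x hx z hz
      simp only [hX, hY, mem_filter, hx, hz, true_and, ← forall_and]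
      refine forall_congr' fun e => ?_
      by_cases heS : e ∈ S
      swap
      · simp [heS]
      have hne := hS e heS
      have hne1 : ¬ (e.1 = i ∧ e.2 = j) := fun h => h1 (by rw [← h.1, ← h.2]; exact heS)
      have hne2 : ¬ (e.1 = j ∧ e.2 = i) := fun h => h2 (by rw [← h.1, ← h.2]; exact heS)
      simp only [heS, true_imp_iff]
      by_cases ha : e.1 = j
      · have hb : e.2 ≠ j := fun hb => hne (ha.trans hb.symm)
        have hc : e.2 ≠ i := fun hc => hne2 ⟨ha, hc⟩
        simp [ha, hb, hc]
      · by_cases hb : e.2 = j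
        · have hc : e.1 ≠ i := fun hc => hne1 ⟨hc, hb⟩
          simp [ha, hb, hc]
        · simp [ha, hb]
    have e1 : ∑ x ∈ B i, ∑ z ∈ B j,
        (if G.Adj (Function.update (Function.update w i x) j z i)
            (Function.update (Function.update w i x) j z j) ∧
          ∀ e ∈ S, G.Adj (Function.update (Function.update w i x) j z e.1)
            (Function.update (Function.update w i x) j z e.2) then (1 : ℝ) else 0) =
        edgeSum G X Y := by
      have hXB : X ⊆ B i := filter_subset _ _
      have hYB : Y ⊆ B j := filter_subset _ _
      have hsplit : edgeSum G X Y = ∑ x ∈ B i, if x ∈ X then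
          ∑ z ∈ B j, (if z ∈ Y then (if G.Adj x z then (1 : ℝ) else 0) else 0) else 0 := by
        rw [Finset.sum_ite_mem, inter_eq_right.2 hXB, edgeSum]
        simp only [Finset.sum_ite_mem, inter_eq_right.2 hYB]
      rw [hsplit]
      refine Finset.sum_congr rfl fun x hx => ?_
      by_cases hxX : x ∈ X
      · rw [if_pos hxX]
        refine Finset.sum_congr rfl fun z hz => ?_
        simp only [hiff x hx z hz]
        by_cases hzY : z ∈ Y <;> simp [hxX, hzY, hij]
      · rw [if_neg hxX]
        refine Finset.sum_eq_zero fun z hz => ?_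
        simp only [hiff x hx z hz, hxX, false_and, and_false, if_false]
    have e2 : ∑ x ∈ B i, ∑ z ∈ B j,
        (if ∀ e ∈ S, G.Adj (Function.update (Function.update w i x) j z e.1)
            (Function.update (Function.update w i x) j z e.2) then (1 : ℝ) else 0) =
        #X * #Y := by
      have : ∀ x ∈ B i, ∀ z ∈ B j,
          (if ∀ e ∈ S, G.Adj (Function.update (Function.update w i x) j z e.1)
            (Function.update (Function.update w i x) j z e.2) then (1 : ℝ) else 0) =
          (if x ∈ X then 1 else 0) * (if z ∈ Y then 1 else 0) := by
        intro x hx z hz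
        rw [if_congr (hiff x hx z hz) rfl rfl]
        by_cases h1 : x ∈ X <;> by_cases h2 : z ∈ Y <;> simp [h1, h2]
      rw [Finset.sum_congr rfl fun x hx => Finset.sum_congr rfl fun z hz => this x hx z hz,
        ← Finset.sum_mul_sum]
      have hXB : X ⊆ B i := filter_subset _ _
      have hYB : Y ⊆ B j := filter_subset _ _
      rw [Finset.sum_ite_mem, Finset.sum_ite_mem, inter_eq_right.2 hXB, inter_eq_right.2 hYB]
      simp
    rw [e1, e2]
    exact hU X (filter_subset _ _) Y (filter_subset _ _)
  have hsum := Finset.sum_le_sum fun w (_ : w ∈ piFinset B) => key w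
  rw [sum_piFinset_resample_two B (fun w =>
      if G.Adj (w i) (w j) ∧ ∀ e ∈ S, G.Adj (w e.1) (w e.2) then (1 : ℝ) else 0),
    Finset.sum_add_distrib, ← Finset.mul_sum,
    sum_piFinset_resample_two B (fun w =>
      if ∀ e ∈ S, G.Adj (w e.1) (w e.2) then (1 : ℝ) else 0), Finset.sum_const, nsmul_eq_mul,
    card_piFinset_eq_boxVol] at hsum
  refine le_of_mul_le_mul_left ?_ (mul_pos hi hj)
  linarith

/-- One-sided counting lemma: if all pairs of parts are upper regular, then the number of clique
tuples is at most what the upper bounds on the densities predict, up to a small error. -/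
theorem sum_forall_adj_le_prod (B : ι → Finset V) (hB : ∀ i, (B i).Nonempty)
    (D : ι → ι → ℝ) {r : ℝ} (hr : 0 ≤ r) (hD0 : ∀ i j, 0 ≤ D i j) (hD1 : ∀ i j, D i j ≤ 1)
    (hU : ∀ i j, i ≠ j → ∀ X ⊆ B i, ∀ Y ⊆ B j,
      edgeSum G X Y ≤ D i j * (#X * #Y) + r * (#(B i) * #(B j)))
    (S : Finset (ι × ι)) (hS : ∀ e ∈ S, e.1 ≠ e.2) (hS' : ∀ e ∈ S, (e.2, e.1) ∉ S) :
    ∑ w ∈ piFinset B, (if ∀ e ∈ S, G.Adj (w e.1) (w e.2) then (1 : ℝ) else 0) ≤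
      (∏ e ∈ S, D e.1 e.2 + #S * r) * boxVol B := by
  induction S using Finset.induction_on with
  | empty => simp [← card_piFinset_eq_boxVol]
  | insert e S he ih =>
    have ih' := ih (fun e' he' => hS e' (mem_insert_of_mem he'))
      (fun e' he' h => hS' e' (mem_insert_of_mem he') (mem_insert_of_mem h))
    have hstep := sum_adj_forall_le G B hB S (i := e.1) (j := e.2)
      (hS e (mem_insert_self _ _)) he
      (fun h => hS' e (mem_insert_self _ _) (mem_insert_of_mem h))
      (fun e' he' => hS e' (mem_insert_of_mem he'))
      (hU e.1 e.2 (hS e (mem_insert_self _ _)))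
    simp only [Finset.forall_mem_insert]
    refine hstep.trans ?_
    rw [prod_insert he, card_insert_of_notMem he]
    have hv := boxVol_nonneg B
    have h1 := mul_le_mul_of_nonneg_left ih' (hD0 e.1 e.2)
    have h2 : D e.1 e.2 * (#S * r * boxVol B) ≤ 1 * (#S * r * boxVol B) :=
      mul_le_mul_of_nonneg_right (hD1 _ _) (by positivity)
    push_cast
    nlinarith

end Counting

/-! ### Products of edge densities are bounded below by the clique density. -/

section Regularity
open scoped Classical
open Finset Fintype

universe u

/-- The pairs `(i, j)` with `i < j`. -/
def ltPairs (n : ℕ) : Finset (Fin n × Fin n) := Finset.univ.filter fun e => e.1 < e.2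

variable {n : ℕ} {V : Type*} (G : SimpleGraph V)

/-- Averaging over a random cell of a product partition preserves edge densities. -/
theorem sum_edgeDens_cells {κ : Type*} (B : Fin n → Finset V) (hB : ∀ i, (B i).Nonempty)
    (f : Fin n → V → κ) {i j : Fin n} (hij : i ≠ j) :
    ∑ w ∈ piFinset B, edgeDens G (fiberCell (f i) (B i) (w i)) (fiberCell (f j) (B j) (w j)) =
      boxVol B * edgeDens G (B i) (B j) := by
  have hi : (0 : ℝ) < #(B i) := by exact_mod_cast (hB i).card_pos
  have hj : (0 : ℝ) < #(B j) := by exact_mod_cast (hB j).card_pos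
  have h := sum_piFinset_pair B hij
    (fun x z => edgeDens G (fiberCell (f i) (B i) x) (fiberCell (f j) (B j) z))
  rw [sum_sum_edgeDens_fiberCell, edgeSum_eq_edgeDens_mul] at h
  have := mul_pos hi hj
  refine mul_left_cancel₀ this.ne' ?_
  rw [h]; ring

/-- If no large subbox has a much smaller product of edge densities, then edge densities cannot
double on large parts with large complement. -/
theorem edgeDens_le_two_mul_of_cells (B : Fin n → Finset V) (hB : ∀ i, (B i).Nonempty) {ρ : ℝ}
    (hρ : 0 < ρ) (hρ1 : ρ ≤ 1)
    (hpos : ∀ C : Fin n → Finset V, (∀ i, C i ⊆ B i ∧ ρ * #(B i) ≤ #(C i)) →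
      ∀ e ∈ ltPairs n, 0 < edgeDens G (C e.1) (C e.2))
    (hmin : ∀ C : Fin n → Finset V, (∀ i, C i ⊆ B i ∧ ρ * #(B i) ≤ #(C i)) →
      ∑ e ∈ ltPairs n, Real.log (edgeDens G (B e.1) (B e.2)) - ρ ^ 2 / 4 ≤
        ∑ e ∈ ltPairs n, Real.log (edgeDens G (C e.1) (C e.2)))
    {i j : Fin n} (hij : i < j) {X Y : Finset V} (hX : X ⊆ B i) (hY : Y ⊆ B j)
    (hX1 : ρ * #(B i) ≤ #X) (hX2 : ρ * #(B i) ≤ #(B i \ X))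
    (hY1 : ρ * #(B j) ≤ #Y) (hY2 : ρ * #(B j) ≤ #(B j \ Y)) :
    edgeDens G X Y ≤ 2 * edgeDens G (B i) (B j) := by
  -- The cells split `B i` into `X` and its complement and `B j` into `Y` and its complement; other
  -- parts stay whole.
  set f : Fin n → V → Prop := fun l u => if l = i then u ∈ X else if l = j then u ∈ Y else True
    with hf
  set C : (Fin n → V) → Fin n → Finset V := fun w l => fiberCell (f l) (B l) (w l) with hC
  have hfilt : ∀ (g : V → Prop) (S T : Finset V) (x : V), T ⊆ S → (∀ u, g u ↔ u ∈ T) →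
      fiberCell g S x = if x ∈ T then T else S \ T := by
    intro g S T x hTS hg
    ext u
    rw [mem_fiberCell]
    simp only [hg, eq_iff_iff]
    by_cases hx : x ∈ T
    · simp only [hx, iff_true, if_true]
      exact ⟨fun h => h.2, fun h => ⟨hTS h, h⟩⟩
    · simp [hx]
  have hCi : ∀ w, C w i = if w i ∈ X then X else B i \ X := fun w =>
    hfilt _ _ _ _ hX fun u => by simp [hf]
  have hCj : ∀ w, C w j = if w j ∈ Y then Y else B j \ Y := fun w =>
    hfilt _ _ _ _ hY fun u => by simp [hf, hij.ne']
  have hCsub : ∀ w l, C w l ⊆ B l ∧ ρ * #(B l) ≤ #(C w l) := by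
    intro w l
    refine ⟨fiberCell_subset _ _ _, ?_⟩
    by_cases hl : l = i
    · subst hl
      rw [hCi]; split_ifs <;> assumption
    by_cases hl' : l = j
    · subst hl'
      rw [hCj]; split_ifs <;> assumption
    · have : C w l = B l := by ext u; simp only [hC, mem_fiberCell, hf, hl, hl', if_false, and_true]
      rw [this]
      exact mul_le_of_le_one_left (by positivity) hρ1
  have hBpos : ∀ e ∈ ltPairs n, 0 < edgeDens G (B e.1) (B e.2) :=
    hpos B fun l => ⟨Subset.rfl, mul_le_of_le_one_left (by positivity) hρ1⟩
  set φ : Fin n × Fin n → (Fin n → V) → ℝ := fun e w =>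
    edgeDens G (C w e.1) (C w e.2) / edgeDens G (B e.1) (B e.2) with hφ
  have hφpos : ∀ e ∈ ltPairs n, ∀ w, 0 < φ e w := fun e he w =>
    div_pos (hpos _ (hCsub w) e he) (hBpos e he)
  have hφsum : ∀ e ∈ ltPairs n, ∑ w ∈ piFinset B, φ e w = boxVol B := by
    intro e he
    have hne : e.1 ≠ e.2 := by
      simp only [ltPairs, mem_filter] at he; exact he.2.ne
    simp only [hφ, ← Finset.sum_div]
    rw [sum_edgeDens_cells G B hB f hne, mul_div_cancel_right₀ _ (hBpos e he).ne']
  have hlog : ∀ w, -(ρ ^ 2 / 4) ≤ ∑ e ∈ ltPairs n, Real.log (φ e w) := by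
    intro w
    have h := hmin _ (hCsub w)
    have : ∑ e ∈ ltPairs n, Real.log (φ e w) =
        ∑ e ∈ ltPairs n, Real.log (edgeDens G (C w e.1) (C w e.2)) -
          ∑ e ∈ ltPairs n, Real.log (edgeDens G (B e.1) (B e.2)) := by
      rw [← Finset.sum_sub_distrib]
      exact Finset.sum_congr rfl fun e he =>
        Real.log_div (hpos _ (hCsub w) e he).ne' (hBpos e he).ne'
    linarith
  have hterm : ∀ e ∈ ltPairs n, ∀ w, 0 ≤ φ e w - 1 - Real.log (φ e w) := fun e he w => by
    linarith [Real.log_le_sub_one_of_pos (hφpos e he w)]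
  have hv := boxVol_pos hB
  -- Each `φ e` has mean 1, while the sum of the logarithms never falls below −ρ²/4. Hence the
  -- nonnegative defects φ − 1 − log φ have total mean at most ρ²/4.
  have htotal : ∑ w ∈ piFinset B, ∑ e ∈ ltPairs n, (φ e w - 1 - Real.log (φ e w)) ≤
      ρ ^ 2 / 4 * boxVol B := by
    have h1 : ∑ w ∈ piFinset B, ∑ e ∈ ltPairs n, (φ e w - 1) = 0 := by
      rw [Finset.sum_comm]
      refine Finset.sum_eq_zero fun e he => ?_
      rw [Finset.sum_sub_distrib, hφsum e he]
      simp [← card_piFinset_eq_boxVol]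
    have h2 : ∑ w ∈ piFinset B, -(ρ ^ 2 / 4) ≤
        ∑ w ∈ piFinset B, ∑ e ∈ ltPairs n, Real.log (φ e w) :=
      Finset.sum_le_sum fun w _ => hlog w
    simp only [Finset.sum_sub_distrib] at h1 ⊢
    rw [Finset.sum_const, nsmul_eq_mul, card_piFinset_eq_boxVol] at h2
    linarith
  have hmem : (i, j) ∈ ltPairs n := by simp [ltPairs, hij]
  set a : ℝ := edgeDens G X Y / edgeDens G (B i) (B j) with ha
  have hi : (0 : ℝ) < #(B i) := by exact_mod_cast (hB i).card_pos
  have hj : (0 : ℝ) < #(B j) := by exact_mod_cast (hB j).card_pos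
  have hXpos : (0 : ℝ) < #X := lt_of_lt_of_le (by positivity) hX1
  have hYpos : (0 : ℝ) < #Y := lt_of_lt_of_le (by positivity) hY1
  have hcell : ∀ w, w i ∈ X → w j ∈ Y → φ (i, j) w = a := by
    intro w h1 h2
    simp only [hφ, ha]
    rw [hCi, hCj, if_pos h1, if_pos h2]
  have hex : ∃ w : Fin n → V, w i ∈ X ∧ w j ∈ Y := by
    obtain ⟨x, hx⟩ := card_pos.1 (Nat.cast_pos.1 hXpos)
    obtain ⟨z, hz⟩ := card_pos.1 (Nat.cast_pos.1 hYpos)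
    exact ⟨fun l => if l = i then x else z, by simp [hx], by simp [hij.ne', hz]⟩
  obtain ⟨w0, hw0⟩ := hex
  have hapos : 0 < a := by rw [← hcell w0 hw0.1 hw0.2]; exact hφpos _ hmem _
  have ha0 : 0 ≤ a - 1 - Real.log a := by rw [← hcell w0 hw0.1 hw0.2]; exact hterm _ hmem _
  have hlow : (∑ w ∈ piFinset B, (if w i ∈ X then (1 : ℝ) else 0) * (if w j ∈ Y then 1 else 0)) *
      (a - 1 - Real.log a) ≤ ρ ^ 2 / 4 * boxVol B := by
    refine le_trans ?_ htotal
    rw [Finset.sum_mul]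
    refine Finset.sum_le_sum fun w _ => ?_
    have hs : φ (i, j) w - 1 - Real.log (φ (i, j) w) ≤
        ∑ e ∈ ltPairs n, (φ e w - 1 - Real.log (φ e w)) :=
      Finset.single_le_sum (f := fun e => φ e w - 1 - Real.log (φ e w))
        (fun e he => hterm e he w) hmem
    by_cases h1 : w i ∈ X
    · by_cases h2 : w j ∈ Y
      · rw [hcell w h1 h2] at hs
        simpa [h1, h2] using hs
      · simp only [h2, if_false, mul_zero, zero_mul]
        exact Finset.sum_nonneg fun e he => hterm e he w
    · simp only [h1, if_false, zero_mul]
      exact Finset.sum_nonneg fun e he => hterm e he w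
  have hcount : (#(B i) : ℝ) * #(B j) *
      ∑ w ∈ piFinset B, (if w i ∈ X then (1 : ℝ) else 0) * (if w j ∈ Y then 1 else 0) =
      boxVol B * (#X * #Y) := by
    rw [sum_piFinset_pair B hij.ne
      (fun x z => (if x ∈ X then (1 : ℝ) else 0) * (if z ∈ Y then 1 else 0)),
      ← Finset.sum_mul_sum, Finset.sum_ite_mem, Finset.sum_ite_mem, inter_eq_right.2 hX,
      inter_eq_right.2 hY]
    simp
  -- A random point lands in `X × Y` with probability at least ρ², so the defect of this one cell is
  -- at most 1/4. Beyond 2 the defect exceeds 1 − log 2 > 1/4.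
  have hge : ρ ^ 2 * boxVol B ≤
      ∑ w ∈ piFinset B, (if w i ∈ X then (1 : ℝ) else 0) * (if w j ∈ Y then 1 else 0) := by
    have h1 : (ρ * #(B i)) * (ρ * #(B j)) ≤ #X * #Y :=
      mul_le_mul hX1 hY1 (by positivity) (by positivity)
    refine le_of_mul_le_mul_left ?_ (mul_pos hi hj)
    rw [hcount]
    nlinarith [mul_le_mul_of_nonneg_left h1 hv.le]
  have hfin : a - 1 - Real.log a ≤ 1 / 4 := by
    have h1 := mul_le_mul_of_nonneg_right hge ha0
    have h2 : 0 < ρ ^ 2 * boxVol B := by positivity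
    refine le_of_mul_le_mul_left ?_ h2
    linarith
  have ha2 : a ≤ 2 := by
    by_contra! h
    have h1 : Real.log a = Real.log 2 + Real.log (a / 2) := by
      rw [← Real.log_mul (by norm_num) (by positivity)]; congr 1; ring
    have h2 := Real.log_le_sub_one_of_pos (show 0 < a / 2 by positivity)
    have h3 := Real.log_two_lt_d9
    linarith
  rwa [ha, div_le_iff₀ (hBpos _ hmem)] at ha2

/-- A small `X` or `Y` is absorbed by the error term. Otherwise shrink both to the minimal
admissible sizes without lowering the density; the subsets are then small enough to have large
complements, so `h` applies to them. -/
theorem edgeSum_le_of_edgeDens_le (P Q : Finset V) {ρ D : ℝ} (hρ : 0 < ρ) (hρ1 : ρ ≤ 1 / 4)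
    (hP : 2 ≤ #P) (hQ : 2 ≤ #Q)
    (h : ∀ X ⊆ P, ∀ Y ⊆ Q, ρ * #P ≤ #X → ρ * #P ≤ #(P \ X) → ρ * #Q ≤ #Y → ρ * #Q ≤ #(Q \ Y) →
      edgeDens G X Y ≤ D) (X Y : Finset V) (hX : X ⊆ P) (hY : Y ⊆ Q) :
    edgeSum G X Y ≤ D * (#X * #Y) + ρ * (#P * #Q) := by
  have hsize : ∀ S : Finset V, 2 ≤ #S → ∀ S' ⊆ S, #S' = ⌈ρ * #S⌉₊ →
      ρ * #S ≤ #S' ∧ ρ * #S ≤ #(S \ S') := by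
    intro S hS S' hS' hc
    have h1 : (#S' : ℝ) < ρ * #S + 1 := by rw [hc]; exact Nat.ceil_lt_add_one (by positivity)
    have h2 : ρ * #S ≤ #S' := by rw [hc]; exact Nat.le_ceil _
    have h3 : (#(S \ S') : ℝ) = #S - #S' := by
      rw [card_sdiff_of_subset hS', Nat.cast_sub (card_le_card hS')]
    have h4 : (2 : ℝ) ≤ #S := by exact_mod_cast hS
    refine ⟨h2, ?_⟩
    rw [h3]
    nlinarith
  have hceil : ∀ S : Finset V, 2 ≤ #S → 1 ≤ ⌈ρ * #S⌉₊ := fun S hS => by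
    have : (0 : ℝ) < #S := by exact_mod_cast (by omega : 0 < #S)
    exact Nat.one_le_iff_ne_zero.2 (Nat.ceil_pos.2 (by positivity)).ne'
  have hD0 : 0 ≤ D := by
    obtain ⟨X', hX', hXc⟩ := exists_subset_card_eq (s := P) (n := ⌈ρ * #P⌉₊)
      (Nat.ceil_le.2 (mul_le_of_le_one_left (by positivity) (by linarith)))
    obtain ⟨Y', hY', hYc⟩ := exists_subset_card_eq (s := Q) (n := ⌈ρ * #Q⌉₊)
      (Nat.ceil_le.2 (mul_le_of_le_one_left (by positivity) (by linarith)))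
    have h1 := hsize P hP X' hX' hXc
    have h2 := hsize Q hQ Y' hY' hYc
    exact (edgeDens_nonneg G X' Y').trans (h X' hX' Y' hY' h1.1 h1.2 h2.1 h2.2)
  have hXle : (#X : ℝ) ≤ #P := by exact_mod_cast card_le_card hX
  have hYle : (#Y : ℝ) ≤ #Q := by exact_mod_cast card_le_card hY
  have hub := edgeSum_le G X Y
  have hDXY : 0 ≤ D * (#X * #Y : ℝ) := by positivity
  by_cases hXs : ρ * #P ≤ #X
  swap
  · have : (#X : ℝ) * #Y ≤ (ρ * #P) * #Q :=
      mul_le_mul (not_le.1 hXs).le hYle (by positivity) (by positivity)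
    linarith
  by_cases hYs : ρ * #Q ≤ #Y
  swap
  · have : (#X : ℝ) * #Y ≤ #P * (ρ * #Q) :=
      mul_le_mul hXle (not_le.1 hYs).le (by positivity) (by positivity)
    linarith
  obtain ⟨X', hX', hXc, hXavg⟩ := exists_subset_card_eq_le_sum X
    (fun x => ∑ z ∈ Y, if G.Adj x z then (1 : ℝ) else 0) (hceil P hP) (Nat.ceil_le.2 hXs)
  obtain ⟨Y', hY', hYc, hYavg⟩ := exists_subset_card_eq_le_sum Y
    (fun z => ∑ x ∈ X', if G.Adj x z then (1 : ℝ) else 0) (hceil Q hQ) (Nat.ceil_le.2 hYs)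
  have h1 := hsize P hP X' (hX'.trans hX) hXc
  have h2 := hsize Q hQ Y' (hY'.trans hY) hYc
  have hd := h X' (hX'.trans hX) Y' (hY'.trans hY) h1.1 h1.2 h2.1 h2.2
  rw [← hXc] at hXavg
  rw [← hYc] at hYavg
  change _ * edgeSum G X Y ≤ _ * edgeSum G X' Y at hXavg
  rw [Finset.sum_comm, Finset.sum_comm (s := Y')] at hYavg
  change _ * edgeSum G X' Y ≤ _ * edgeSum G X' Y' at hYavg
  have hX'pos : (0 : ℝ) < #X' := by
    rw [hXc]; exact_mod_cast (hceil P hP)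
  have hY'pos : (0 : ℝ) < #Y' := by
    rw [hYc]; exact_mod_cast (hceil Q hQ)
  rw [edgeSum_eq_edgeDens_mul G X' Y'] at hYavg
  have h3 : #X' * #Y' * edgeSum G X Y ≤ #X' * #Y' * (D * (#X * #Y)) := by
    calc (#X' : ℝ) * #Y' * edgeSum G X Y = #Y' * (#X' * edgeSum G X Y) := by ring
      _ ≤ #Y' * (#X * edgeSum G X' Y) := by gcongr
      _ = #X * (#Y' * edgeSum G X' Y) := by ring
      _ ≤ #X * (#Y * (edgeDens G X' Y' * (#X' * #Y'))) := by gcongr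
      _ ≤ #X * (#Y * (D * (#X' * #Y'))) := by gcongr
      _ = _ := by ring
  have h4 := le_of_mul_le_mul_left h3 (mul_pos hX'pos hY'pos)
  have : 0 ≤ ρ * (#P * #Q : ℝ) := by positivity
  linarith

set_option maxHeartbeats 1000000 in
/-- If all large subboxes have clique density at least `y`, then the product of the edge densities
is at least a constant multiple of `y`. -/
theorem exists_prod_edgeDens_lower (n : ℕ) {y : ℝ} (hy : 0 < y) (hy1 : y ≤ 1) :
    ∃ ρ : ℝ, 0 < ρ ∧ ρ ≤ 1 ∧ ∀ (V : Type u) (G : SimpleGraph V) (A : Fin n → Finset V),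
      (∀ i, 2 ≤ ρ * #(A i)) →
      (∀ B : Fin n → Finset V, (∀ i, B i ⊆ A i ∧ ρ * #(A i) ≤ #(B i)) → y ≤ cliqueDens G B) →
      y / 2 ^ (#(ltPairs n) + 1) ≤ ∏ e ∈ ltPairs n, edgeDens G (A e.1) (A e.2) := by
  set m := #(ltPairs n) with hm
  -- Keeps the counting error `m * ρ1` below `y / 2`.
  set ρ1 : ℝ := y / (4 * (m + 1)) with hρ1
  have hm0 : (0 : ℝ) ≤ m := Nat.cast_nonneg m
  have hρ1pos : 0 < ρ1 := by positivity
  have hρ1le : ρ1 ≤ 1 / 4 := by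
    rw [hρ1, div_le_iff₀ (by positivity)]; linarith
  set L : ℝ := Real.log (1 / ρ1) with hL
  have hLpos : 0 < L := Real.log_pos (by rw [lt_div_iff₀ hρ1pos]; linarith)
  -- Shrinking all parts by a factor `ρ1` changes the size penalty in `J` by at most `κ * (n * L)`,
  -- which has to fit in the slack ρ1²/4 of `edgeDens_le_two_mul_of_cells`.
  set κ : ℝ := ρ1 ^ 2 / (4 * (n + 1) * L) with hκ
  have hκpos : 0 < κ := by positivity
  have hκn : κ * (n * L) ≤ ρ1 ^ 2 / 4 := by
    rw [hκ, div_mul_eq_mul_div, div_le_div_iff₀ (by positivity) (by norm_num)]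
    nlinarith [mul_pos (pow_pos hρ1pos 2) hLpos]
  have hly : 0 ≤ Real.log (1 / y) := Real.log_nonneg (by rw [le_div_iff₀ hy]; linarith)
  -- A minimiser of `J` has `J ≤ 0` and edge densities at least `y`, so the penalty forces relative
  -- part sizes at least `r0`. Its subboxes at scale `ρ1` are therefore still admissible
  -- competitors.
  set r0 : ℝ := Real.exp (-(m * Real.log (1 / y) / κ)) with hr0
  have hr0pos : 0 < r0 := Real.exp_pos _
  have hr0le : r0 ≤ 1 := Real.exp_le_one_iff.2 (by
    have : 0 ≤ m * Real.log (1 / y) / κ := by positivity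
    linarith)
  have hρle : r0 * ρ1 ≤ 1 := by nlinarith
  refine ⟨r0 * ρ1, by positivity, hρle, ?_⟩
  intro V G A hA2 hden
  have hsz : ∀ B : Fin n → Finset V, (∀ i, B i ⊆ A i ∧ r0 * ρ1 * #(A i) ≤ #(B i)) →
      ∀ i, 2 ≤ #(B i) := fun B hB i => by
    exact_mod_cast (hA2 i).trans (hB i).2
  have hed : ∀ B : Fin n → Finset V, (∀ i, B i ⊆ A i ∧ r0 * ρ1 * #(A i) ≤ #(B i)) →
      ∀ i j, i ≠ j → y ≤ edgeDens G (B i) (B j) := fun B hB i j hij =>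
    (hden B hB).trans (cliqueDens_le_edgeDens G B
      (fun i => card_pos.1 (by have := hsz B hB i; omega)) hij)
  have hltne : ∀ e ∈ ltPairs n, e.1 ≠ e.2 := fun e he => by
    simp only [ltPairs, mem_filter] at he; exact he.2.ne
  set J : (Fin n → Finset V) → ℝ := fun B =>
    ∑ e ∈ ltPairs n, Real.log (edgeDens G (B e.1) (B e.2)) -
      κ * ∑ i, Real.log (#(B i) / #(A i)) with hJ
  set 𝓑 : Finset (Fin n → Finset V) :=
    piFinset fun i => (A i).powerset.filter fun S => r0 * ρ1 * #(A i) ≤ #S with h𝓑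
  have hmem𝓑 : ∀ B, B ∈ 𝓑 ↔ ∀ i, B i ⊆ A i ∧ r0 * ρ1 * #(A i) ≤ #(B i) := by
    intro B; simp [h𝓑, mem_piFinset]
  have hA𝓑 : A ∈ 𝓑 := (hmem𝓑 A).2 fun i =>
    ⟨Subset.rfl, mul_le_of_le_one_left (by positivity) hρle⟩
  obtain ⟨B, hB, hBmin⟩ := 𝓑.exists_min_image J ⟨A, hA𝓑⟩
  have hB' := (hmem𝓑 B).1 hB
  have hA' := (hmem𝓑 A).1 hA𝓑
  have hApos : ∀ i, (0 : ℝ) < #(A i) := fun i => by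
    have := hsz A hA' i; exact_mod_cast (by omega : 0 < #(A i))
  have hcpos : ∀ C ∈ 𝓑, ∀ i, (0 : ℝ) < #(C i) := fun C hC i => by
    have := hsz C ((hmem𝓑 C).1 hC) i; exact_mod_cast (by omega : 0 < #(C i))
  have hJA : J A = ∑ e ∈ ltPairs n, Real.log (edgeDens G (A e.1) (A e.2)) := by
    have : ∀ i, Real.log ((#(A i) : ℝ) / #(A i)) = 0 := fun i => by
      rw [div_self (hApos i).ne', Real.log_one]
    simp [hJ, this]
  have hratio : ∀ C ∈ 𝓑, ∀ i, Real.log (#(C i) / #(A i)) ≤ 0 := fun C hC i =>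
    Real.log_nonpos (by positivity) (div_le_one_of_le₀
      (by exact_mod_cast card_le_card ((hmem𝓑 C).1 hC i).1) (by positivity))
  have hJA0 : J A ≤ 0 := by
    rw [hJA]
    exact Finset.sum_nonpos fun e _ =>
      Real.log_nonpos (edgeDens_nonneg G _ _) (edgeDens_le_one G _ _)
  have hBA : J B ≤ J A := hBmin A hA𝓑
  have hlogB : -(m * Real.log (1 / y)) ≤
      ∑ e ∈ ltPairs n, Real.log (edgeDens G (B e.1) (B e.2)) := by
    have : ∑ e ∈ ltPairs n, Real.log y ≤
        ∑ e ∈ ltPairs n, Real.log (edgeDens G (B e.1) (B e.2)) :=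
      Finset.sum_le_sum fun e he => Real.log_le_log hy (hed B hB' _ _ (hltne e he))
    rw [Finset.sum_const, nsmul_eq_mul] at this
    rw [one_div, Real.log_inv]; linarith
  have hBlarge : ∀ i, r0 * #(A i) ≤ #(B i) := by
    intro i
    have h1 : ∑ l, Real.log (#(B l) / #(A l)) ≤ Real.log (#(B i) / #(A i)) := by
      have h2 := Finset.add_sum_erase Finset.univ
        (fun l => Real.log ((#(B l) : ℝ) / #(A l))) (Finset.mem_univ i)
      have h3 : ∑ l ∈ Finset.univ.erase i, Real.log ((#(B l) : ℝ) / #(A l)) ≤ 0 :=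
        Finset.sum_nonpos fun l _ => hratio B hB l
      linarith
    have h2 : -(m * Real.log (1 / y)) ≤ κ * Real.log (#(B i) / #(A i)) := by
      have := mul_le_mul_of_nonneg_left h1 hκpos.le
      have h4 := hBA.trans hJA0
      simp only [hJ] at h4
      linarith
    have h3 : -(m * Real.log (1 / y) / κ) ≤ Real.log (#(B i) / #(A i)) := by
      rw [← neg_div, div_le_iff₀ hκpos]; linarith
    have h5 := Real.exp_le_exp.2 h3
    rw [Real.exp_log (div_pos (hcpos B hB i) (hApos i)), le_div_iff₀ (hApos i)] at h5
    exact h5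
  have hsub𝓑 : ∀ C : Fin n → Finset V, (∀ i, C i ⊆ B i ∧ ρ1 * #(B i) ≤ #(C i)) → C ∈ 𝓑 := by
    intro C hC
    refine (hmem𝓑 C).2 fun i => ⟨(hC i).1.trans (hB' i).1, le_trans ?_ (hC i).2⟩
    have := mul_le_mul_of_nonneg_left (hBlarge i) hρ1pos.le
    linarith
  have hBne : ∀ i, (B i).Nonempty := fun i => card_pos.1 (by have := hsz B hB' i; omega)
  have htwo : ∀ i j : Fin n, i < j → ∀ X ⊆ B i, ∀ Y ⊆ B j, ρ1 * #(B i) ≤ #X →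
      ρ1 * #(B i) ≤ #(B i \ X) → ρ1 * #(B j) ≤ #Y → ρ1 * #(B j) ≤ #(B j \ Y) →
      edgeDens G X Y ≤ 2 * edgeDens G (B i) (B j) := by
    intro i j hij X hX Y hY h1 h2 h3 h4
    refine edgeDens_le_two_mul_of_cells G B hBne hρ1pos (by linarith) ?_ ?_ hij hX hY h1 h2 h3 h4
    · intro C hC e he
      exact hy.trans_le (hed C ((hmem𝓑 C).1 (hsub𝓑 C hC)) _ _ (hltne e he))
    · intro C hC
      have hC𝓑 := hsub𝓑 C hC
      have h5 := hBmin C hC𝓑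
      simp only [hJ] at h5
      have h6 : ∑ i, Real.log (#(B i) / #(A i)) - ∑ i, Real.log (#(C i) / #(A i)) ≤ n * L := by
        rw [← Finset.sum_sub_distrib]
        calc ∑ i, (Real.log (#(B i) / #(A i)) - Real.log (#(C i) / #(A i))) ≤
            ∑ _i : Fin n, L := by
              refine Finset.sum_le_sum fun i _ => ?_
              rw [Real.log_div (hcpos B hB i).ne' (hApos i).ne',
                Real.log_div (hcpos C hC𝓑 i).ne' (hApos i).ne', hL, one_div, Real.log_inv]
              have h7 := Real.log_le_log (by have := hcpos B hB i; positivity) (hC i).2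
              rw [Real.log_mul hρ1pos.ne' (hcpos B hB i).ne'] at h7
              linarith
          _ = n * L := by simp
      have h7 := mul_le_mul_of_nonneg_left h6 hκpos.le
      linarith
  -- Truncating at 1 keeps the errors in the counting lemma additive.
  set D : Fin n → Fin n → ℝ := fun i j => min 1 (2 * edgeDens G (B i) (B j)) with hD
  have hUlt : ∀ i j : Fin n, i < j → ∀ X ⊆ B i, ∀ Y ⊆ B j,
      edgeSum G X Y ≤ D i j * (#X * #Y) + ρ1 * (#(B i) * #(B j)) := by
    intro i j hij X hX Y hY
    have h1 := edgeSum_le_of_edgeDens_le G (B i) (B j) hρ1pos hρ1le (hsz B hB' i) (hsz B hB' j)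
      (htwo i j hij) X Y hX hY
    rcases min_choice 1 (2 * edgeDens G (B i) (B j)) with h | h
    · simp only [hD, h]
      have := edgeSum_le G X Y
      have h2 : 0 ≤ ρ1 * (#(B i) * #(B j) : ℝ) := by positivity
      linarith
    · simp only [hD, h]; exact h1
  have hU : ∀ i j : Fin n, i ≠ j → ∀ X ⊆ B i, ∀ Y ⊆ B j,
      edgeSum G X Y ≤ D i j * (#X * #Y) + ρ1 * (#(B i) * #(B j)) := by
    intro i j hij X hX Y hY
    rcases lt_or_gt_of_ne hij with h | h
    · exact hUlt i j h X hX Y hY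
    · have := hUlt j i h Y hY X hX
      rw [edgeSum_comm, show D i j = D j i by simp only [hD, edgeDens_comm G (B i)]]
      linarith
  have hcount := sum_forall_adj_le_prod G B hBne D hρ1pos.le
    (fun i j => le_min zero_le_one (by have := edgeDens_nonneg G (B i) (B j); positivity))
    (fun i j => min_le_left _ _) hU (ltPairs n) hltne
    (fun e he h => by
      simp only [ltPairs, mem_filter] at he h; exact lt_asymm he.2 h.2)
  have hvB := boxVol_pos hBne
  have h1 : y * boxVol B ≤ cliqueSum G B := by
    have := hden B hB'
    rwa [cliqueDens, le_div_iff₀ hvB] at this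
  have h2 : cliqueSum G B ≤ ∑ w ∈ piFinset B,
      (if ∀ e ∈ ltPairs n, G.Adj (w e.1) (w e.2) then (1 : ℝ) else 0) := by
    refine Finset.sum_le_sum fun w _ => ?_
    by_cases hw : IsCliqueTuple G w
    · rw [if_pos hw, if_pos fun e he => hw _ _ (hltne e he)]
    · rw [if_neg hw]; split_ifs <;> norm_num
  have h3 : y ≤ ∏ e ∈ ltPairs n, D e.1 e.2 + m * ρ1 :=
    le_of_mul_le_mul_right ((h1.trans h2).trans hcount) hvB
  have h4 : ∏ e ∈ ltPairs n, D e.1 e.2 ≤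
      2 ^ m * ∏ e ∈ ltPairs n, edgeDens G (B e.1) (B e.2) := by
    calc ∏ e ∈ ltPairs n, D e.1 e.2 ≤ ∏ e ∈ ltPairs n, 2 * edgeDens G (B e.1) (B e.2) :=
          Finset.prod_le_prod
            (fun e _ => le_min zero_le_one (by have := edgeDens_nonneg G (B e.1) (B e.2); positivity))
            (fun e _ => min_le_right _ _)
      _ = _ := by rw [Finset.prod_mul_distrib, Finset.prod_const]
  have h5 : m * ρ1 ≤ y / 2 := by
    rw [hρ1, mul_div_assoc', div_le_div_iff₀ (by positivity) (by norm_num)]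
    nlinarith
  have h6 : y / 2 ^ (m + 1) ≤ ∏ e ∈ ltPairs n, edgeDens G (B e.1) (B e.2) := by
    rw [div_le_iff₀ (by positivity), pow_succ]
    linarith
  refine h6.trans ?_
  have hposprod : ∀ C ∈ 𝓑, ∀ e ∈ ltPairs n, 0 < edgeDens G (C e.1) (C e.2) :=
    fun C hC e he => hy.trans_le (hed C ((hmem𝓑 C).1 hC) _ _ (hltne e he))
  rw [← Real.log_le_log_iff (Finset.prod_pos (hposprod B hB)) (Finset.prod_pos (hposprod A hA𝓑)),
    Real.log_prod fun e he => (hposprod B hB e he).ne',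
    Real.log_prod fun e he => (hposprod A hA𝓑 e he).ne', ← hJA]
  -- The penalty is nonnegative at `B` and zero at `A`, so `J B ≤ J A` carries the lower bound from
  -- `B` to `A`.
  refine le_trans ?_ hBA
  have : ∑ i, Real.log (#(B i) / #(A i)) ≤ 0 := Finset.sum_nonpos fun i _ => hratio B hB i
  simp only [hJ]
  nlinarith

end Regularity

/-! ### A vertex with a large product of relative degrees. -/

section LargeDegrees
open scoped Classical
open Finset Fintype

universe u

/-- Each pair of parts is seen from both ends; this doubling is the source of the 2 in the exponent
2/n. -/
theorem sum_ltPairs_add_swap {n : ℕ} (F : Fin n → Fin n → ℝ) :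
    ∑ e ∈ ltPairs n, (F e.1 e.2 + F e.2 e.1) = ∑ i, ∑ j ∈ Finset.univ.erase i, F i j := by
  have h1 : ∑ i, ∑ j ∈ Finset.univ.erase i, F i j =
      ∑ e : Fin n × Fin n, if e.1 ≠ e.2 then F e.1 e.2 else 0 := by
    rw [Fintype.sum_prod_type]
    refine Finset.sum_congr rfl fun i _ => ?_
    rw [← Finset.sum_filter]
    refine Finset.sum_congr ?_ fun _ _ => rfl
    ext j; simp [eq_comm]
  have h2 : ∑ e ∈ ltPairs n, F e.2 e.1 =
      ∑ e : Fin n × Fin n, if e.2 < e.1 then F e.1 e.2 else 0 := by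
    rw [ltPairs, Finset.sum_filter]
    exact Finset.sum_nbij' Prod.swap Prod.swap (by simp) (by simp) (by simp) (by simp) (by simp)
  rw [Finset.sum_add_distrib, h1, h2, ltPairs, Finset.sum_filter, ← Finset.sum_add_distrib]
  refine Finset.sum_congr rfl fun e _ => ?_
  rcases lt_trichotomy e.1 e.2 with h | h | h
  · simp [h, h.ne, h.not_gt]
  · simp [h]
  · simp [h, h.ne', h.not_gt]

theorem prod_add_le_prod_add {α : Type*} (S : Finset α) (p : α → ℝ) (hp0 : ∀ a, 0 ≤ p a)
    (hp1 : ∀ a, p a ≤ 1) {ξ : ℝ} (hξ0 : 0 ≤ ξ) (hξ1 : ξ ≤ 1) :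
    ∏ a ∈ S, (p a + ξ) ≤ ∏ a ∈ S, p a + (2 ^ #S - 1) * ξ := by
  induction S using Finset.induction_on with
  | empty => simp
  | insert a S ha ih =>
    rw [prod_insert ha, prod_insert ha, card_insert_of_notMem ha, pow_succ]
    have h1 : ∏ a ∈ S, p a ≤ 1 := Finset.prod_le_one (fun a _ => hp0 a) (fun a _ => hp1 a)
    have h2 : (1 : ℝ) ≤ 2 ^ #S := one_le_pow₀ (by norm_num)
    have h3 := mul_le_mul_of_nonneg_left ih (add_nonneg (hp0 a) hξ0)
    have h4 : 0 ≤ (2 ^ #S - 1) * ξ := mul_nonneg (by linarith) hξ0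
    have h5 : (p a + ξ) * ((2 ^ #S - 1) * ξ) ≤ 2 * ((2 ^ #S - 1) * ξ) :=
      mul_le_mul_of_nonneg_right (by linarith [hp1 a]) h4
    nlinarith [mul_le_mul_of_nonneg_left h1 hξ0]

variable {V : Type*} (G : SimpleGraph V)

/-- The proportion of vertices of `X` adjacent to `v`. -/
noncomputable def relDegree (X : Finset V) (v : V) : ℝ := #(X.filter fun x => G.Adj v x) / #X

theorem relDegree_nonneg (X : Finset V) (v : V) : 0 ≤ relDegree G X v := by
  unfold relDegree; positivity

theorem relDegree_le_one (X : Finset V) (v : V) : relDegree G X v ≤ 1 :=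
  div_le_one_of_le₀ (by exact_mod_cast card_le_card (filter_subset _ _)) (by positivity)

theorem edgeSum_eq_sum_relDegree (X Y : Finset V) :
    edgeSum G X Y = #Y * ∑ x ∈ X, relDegree G Y x := by
  rw [edgeSum, Finset.mul_sum]
  refine Finset.sum_congr rfl fun x _ => ?_
  rw [relDegree]
  by_cases h : (#Y : ℝ) = 0
  · have : Y = ∅ := by simpa using h
    simp [this]
  · rw [mul_div_cancel₀ _ h, Finset.sum_ite]
    simp

theorem edgeDens_le_of_relDegree_le {X Y : Finset V} (hX : X.Nonempty) {q : ℝ}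
    (h : ∀ x ∈ X, relDegree G Y x ≤ q) : edgeDens G X Y ≤ q := by
  have hXpos : (0 : ℝ) < #X := by exact_mod_cast hX.card_pos
  have hs : ∑ x ∈ X, relDegree G Y x ≤ #X * q := by
    simpa using Finset.sum_le_card_nsmul X _ q h
  obtain ⟨x, hx⟩ := hX
  have hq : 0 ≤ q := (relDegree_nonneg G Y x).trans (h x hx)
  rw [edgeDens, edgeSum_eq_sum_relDegree]
  refine div_le_of_le_mul₀ (by positivity) hq ?_
  have := mul_le_mul_of_nonneg_left hs (Nat.cast_nonneg (α := ℝ) #Y)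
  linarith

theorem edgeDens_le_two_mul_of_card_le {X Y Y' : Finset V} (hY : Y' ⊆ Y)
    (hc : (#Y : ℝ) ≤ 2 * #Y') : edgeDens G X Y' ≤ 2 * edgeDens G X Y := by
  by_cases h0 : (#X * #Y' : ℝ) = 0
  · rw [edgeDens, h0, div_zero]
    have := edgeDens_nonneg G X Y
    positivity
  · have hX : (0 : ℝ) < #X := lt_of_le_of_ne (by positivity) fun h => h0 (by rw [← h, zero_mul])
    have hY' : (0 : ℝ) < #Y' :=
      lt_of_le_of_ne (by positivity) fun h => h0 (by rw [← h, mul_zero])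
    have hY2 : (0 : ℝ) < #Y := hY'.trans_le (by exact_mod_cast card_le_card hY)
    have h1 := edgeSum_mono G (Subset.refl X) hY
    have h2 := edgeSum_nonneg G X Y
    rw [edgeDens, edgeDens, mul_div_assoc', div_le_div_iff₀ (by positivity) (by positivity)]
    calc edgeSum G X Y' * (#X * #Y) ≤ edgeSum G X Y * (#X * (2 * #Y')) := by gcongr
      _ = _ := by ring

/-- Vertices in cells of small relative size form a small set. -/
theorem card_le_two_mul_card_filter_fiberCell {κ : Type*} (f : V → κ) (A : Finset V)
    (K : Finset κ) (hK : ∀ v ∈ A, f v ∈ K) {ρ : ℝ} (hρ0 : 0 ≤ ρ)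
    (hρ : ρ * #K ≤ 1 / 2) :
    (#A : ℝ) ≤ 2 * #(A.filter fun v => ρ * #A ≤ #(fiberCell f A v)) := by
  set S := A.filter fun v => ¬ ρ * #A ≤ #(fiberCell f A v) with hS
  have hcard : (#(A.filter fun v => ρ * #A ≤ #(fiberCell f A v)) : ℝ) + #S = #A := by
    exact_mod_cast card_filter_add_card_filter_not (s := A)
      (fun v => ρ * #A ≤ #(fiberCell f A v))
  have hSle : (#S : ℝ) ≤ #K * (ρ * #A) := by
    have h1 : #S = ∑ c ∈ K, #(S.filter fun v => f v = c) :=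
      card_eq_sum_card_fiberwise fun v hv => hK v (mem_filter.1 hv).1
    have h2 : ∀ c ∈ K, (#(S.filter fun v => f v = c) : ℝ) ≤ ρ * #A := by
      intro c _
      rcases (S.filter fun v => f v = c).eq_empty_or_nonempty with h | ⟨v, hv⟩
      · rw [h, Finset.card_empty, Nat.cast_zero]
        positivity
      · rw [mem_filter, hS, mem_filter] at hv
        have hsub : (S.filter fun v => f v = c) ⊆ fiberCell f A v := by
          intro u hu
          rw [mem_filter, hS, mem_filter] at hu
          exact mem_fiberCell.2 ⟨hu.1.1, hu.2.trans hv.2.symm⟩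
        exact (by exact_mod_cast card_le_card hsub : (_ : ℝ) ≤ #(fiberCell f A v)).trans
          (not_le.1 hv.1.2).le
    rw [h1]
    push_cast
    simpa using Finset.sum_le_card_nsmul K _ _ h2
  have : #K * (ρ * #A) ≤ 1 / 2 * (#A : ℝ) := by
    have := mul_le_mul_of_nonneg_right hρ (Nat.cast_nonneg (α := ℝ) #A)
    linarith
  linarith

/-- For a fixed cell of `B i`, averaging over the cells of `B j` gives its density to all of `B j`,
which is at most `q`. So density divided by `q` has mean at most 1, and log x ≤ x − 1 yields the
bound. -/
theorem sum_log_edgeDens_cells_le {n : ℕ} {κ : Type*} (f : V → κ) (B : Fin n → Finset V)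
    (hB : ∀ i, (B i).Nonempty) {i j : Fin n} (hij : i ≠ j) (q : V → ℝ) (hq : ∀ v, 0 < q v)
    (hpos : ∀ w ∈ piFinset B, 0 < edgeDens G (fiberCell f (B i) (w i)) (fiberCell f (B j) (w j)))
    (hle : ∀ v ∈ B i, edgeDens G (fiberCell f (B i) v) (B j) ≤ q v) :
    ∑ w ∈ piFinset B,
      Real.log (edgeDens G (fiberCell f (B i) (w i)) (fiberCell f (B j) (w j))) ≤
        ∑ w ∈ piFinset B, Real.log (q (w i)) := by
  have hi : (0 : ℝ) < #(B i) := by exact_mod_cast (hB i).card_pos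
  have hj : (0 : ℝ) < #(B j) := by exact_mod_cast (hB j).card_pos
  have h1 : ∑ w ∈ piFinset B,
      edgeDens G (fiberCell f (B i) (w i)) (fiberCell f (B j) (w j)) / q (w i) ≤ boxVol B := by
    refine le_of_mul_le_mul_left ?_ (mul_pos hi hj)
    rw [sum_piFinset_pair B hij
      (fun x z => edgeDens G (fiberCell f (B i) x) (fiberCell f (B j) z) / q x), mul_comm]
    refine mul_le_mul_of_nonneg_right ?_ (boxVol_nonneg B)
    calc ∑ x ∈ B i, ∑ z ∈ B j, edgeDens G (fiberCell f (B i) x) (fiberCell f (B j) z) / q x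
        ≤ ∑ x ∈ B i, (#(B j) : ℝ) := by
          refine Finset.sum_le_sum fun x hx => ?_
          rw [← Finset.sum_div, sum_edgeDens_fiberCell, div_le_iff₀ (hq x)]
          exact mul_le_mul_of_nonneg_left (hle x hx) hj.le
      _ = _ := by simp
  have h2 : ∀ w ∈ piFinset B,
      Real.log (edgeDens G (fiberCell f (B i) (w i)) (fiberCell f (B j) (w j))) ≤
        Real.log (q (w i)) +
          (edgeDens G (fiberCell f (B i) (w i)) (fiberCell f (B j) (w j)) / q (w i) - 1) := by
    intro w hw
    have := Real.log_le_sub_one_of_pos (div_pos (hpos w hw) (hq (w i)))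
    rw [Real.log_div (hpos w hw).ne' (hq _).ne'] at this
    linarith
  have h3 := Finset.sum_le_sum h2
  rw [Finset.sum_add_distrib, Finset.sum_sub_distrib] at h3
  simp only [Finset.sum_const, nsmul_eq_mul, mul_one, card_piFinset_eq_boxVol] at h3
  linarith

/-- The constant in `exists_vertex_prod_relDegree`. -/
noncomputable def degreeConst (n : ℕ) : ℝ := 1 / (2 ^ (#(ltPairs n) + 1)) ^ 2 / 2 ^ (n + 1)

theorem degreeConst_pos (n : ℕ) : 0 < degreeConst n := by unfold degreeConst; positivity

set_option maxHeartbeats 1000000 in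
/-- If all large subboxes have clique density at least `y`, then some vertex of some part has large
degree to the other parts, in the sense that the product of its relative degrees is large. -/
theorem exists_vertex_prod_relDegree {n : ℕ} (hn : 1 ≤ n) {y : ℝ} (hy : 0 < y) (hy1 : y ≤ 1) :
    ∃ ρ : ℝ, 0 < ρ ∧ ρ ≤ 1 ∧ ∀ (V : Type u) (G : SimpleGraph V) (A : Fin n → Finset V),
      (∀ i, 2 ≤ ρ * #(A i)) →
      (∀ B : Fin n → Finset V, (∀ i, B i ⊆ A i ∧ ρ * #(A i) ≤ #(B i)) → y ≤ cliqueDens G B) →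
      ∃ i, ∃ v ∈ A i, degreeConst n * y ^ ((2 : ℝ) / n) ≤
        ∏ j ∈ Finset.univ.erase i, relDegree G (A j) v := by
  obtain ⟨ρs, hρs, hρs1, hstar⟩ := exists_prod_edgeDens_lower.{u} n hy hy1
  set cs : ℝ := 1 / 2 ^ (#(ltPairs n) + 1) with hcs
  have hcspos : 0 < cs := by positivity
  set p : ℝ := degreeConst n * y ^ ((2 : ℝ) / n) with hp
  have hppos : 0 < p := mul_pos (degreeConst_pos n) (Real.rpow_pos_of_pos hy _)
  have hcs1 : cs ≤ 1 := by
    rw [hcs, div_le_one (by positivity)]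
    exact one_le_pow₀ (by norm_num)
  have hdc : degreeConst n * 2 ^ (n + 1) = cs ^ 2 := by
    rw [degreeConst, hcs]; field_simp
  have hp1 : p ≤ 1 := by
    have h1 : y ^ ((2 : ℝ) / n) ≤ 1 := Real.rpow_le_one hy.le hy1 (by positivity)
    have h2 : degreeConst n ≤ 1 := by
      have h3 : (1 : ℝ) ≤ 2 ^ (n + 1) := one_le_pow₀ (by norm_num)
      nlinarith [degreeConst_pos n]
    exact mul_le_one₀ h2 (Real.rpow_nonneg hy.le _) h1
  -- Mesh for rounding relative degrees: over n − 1 factors the rounding changes the product by at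
  -- most `p`. The number of rounded profiles, `#K`, depends only on `n` and `y`.
  set ξ : ℝ := p / 2 ^ n with hξ
  have hξpos : 0 < ξ := by positivity
  have hξ1 : ξ ≤ 1 := div_le_one_of_le₀
    (hp1.trans (one_le_pow₀ (by norm_num))) (by positivity)
  set K : Finset (Fin n → ℕ) := piFinset fun _ => Finset.range (⌊1 / ξ⌋₊ + 1) with hK
  set ρ' : ℝ := 1 / (2 * #K) with hρ'
  have hKpos : (0 : ℝ) < #K := by
    have : K.Nonempty := ⟨fun _ => 0, by simp [hK, mem_piFinset]⟩
    exact_mod_cast this.card_pos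
  have hρ'pos : 0 < ρ' := by positivity
  have hρ'1 : ρ' ≤ 1 := by
    have h1 : (1 : ℝ) ≤ #K := by exact_mod_cast hKpos
    rw [hρ', div_le_one (by positivity)]
    linarith
  refine ⟨ρ' * ρs, by positivity, by nlinarith, ?_⟩
  intro V G A hA2 hden
  by_contra! hcon
  have hApos : ∀ i, (0 : ℝ) < #(A i) := fun i => by
    by_contra! h
    have h1 := hA2 i
    have : ρ' * ρs * (#(A i) : ℝ) ≤ 0 := mul_nonpos_of_nonneg_of_nonpos (by positivity) h
    linarith
  set f : V → Fin n → ℕ := fun v j => ⌊relDegree G (A j) v / ξ⌋₊ with hf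
  have hfK : ∀ v, f v ∈ K := by
    intro v
    simp only [hK, mem_piFinset, Finset.mem_range, hf]
    intro j
    refine Nat.lt_succ_of_le (Nat.floor_le_floor ?_)
    exact div_le_div_of_nonneg_right (relDegree_le_one G _ _) hξpos.le
  have hfclose : ∀ u v, f u = f v → ∀ j, relDegree G (A j) u ≤ relDegree G (A j) v + ξ := by
    intro u v huv j
    have h1 : ⌊relDegree G (A j) u / ξ⌋₊ = ⌊relDegree G (A j) v / ξ⌋₊ := congrFun huv j
    have h2 := Nat.lt_floor_add_one (relDegree G (A j) u / ξ)
    have h3 := Nat.floor_le (a := relDegree G (A j) v / ξ)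
      (div_nonneg (relDegree_nonneg G _ _) hξpos.le)
    rw [h1] at h2
    have h4 : relDegree G (A j) u / ξ < relDegree G (A j) v / ξ + 1 := by linarith
    rw [div_add_one hξpos.ne', div_lt_div_iff_of_pos_right hξpos] at h4
    exact h4.le
  -- Vertices with rare profiles are discarded, keeping at least half of each part. As `B i` is a
  -- union of cells of `A i`, the surviving cells do not shrink.
  set B : Fin n → Finset V := fun i => (A i).filter fun v => ρ' * #(A i) ≤ #(fiberCell f (A i) v)
    with hB
  have hBA : ∀ i, B i ⊆ A i := fun i => filter_subset _ _
  have hBcard : ∀ i, (#(A i) : ℝ) ≤ 2 * #(B i) := fun i =>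
    card_le_two_mul_card_filter_fiberCell f (A i) K (fun v _ => hfK v) hρ'pos.le
      (by rw [hρ']; field_simp; exact le_rfl)
  have hBne : ∀ i, (B i).Nonempty := fun i => by
    have : (0 : ℝ) < #(B i) := by linarith [hApos i, hBcard i]
    exact card_pos.1 (by exact_mod_cast this)
  have hcell : ∀ i, ∀ v ∈ B i, fiberCell f (B i) v = fiberCell f (A i) v := by
    intro i v hv
    ext u
    simp only [mem_fiberCell]
    refine ⟨fun h => ⟨hBA i h.1, h.2⟩, fun h => ⟨?_, h.2⟩⟩
    rw [hB, mem_filter] at hv ⊢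
    refine ⟨h.1, ?_⟩
    have : fiberCell f (A i) u = fiberCell f (A i) v := by
      ext z; simp only [mem_fiberCell, h.2]
    rw [this]; exact hv.2
  have hcellcard : ∀ i, ∀ v ∈ B i, ρ' * #(A i) ≤ #(fiberCell f (B i) v) := by
    intro i v hv
    rw [hcell i v hv]
    rw [hB, mem_filter] at hv
    exact hv.2
  have hprod : ∀ w ∈ piFinset B, cs * y ≤ ∏ e ∈ ltPairs n,
      edgeDens G (fiberCell f (B e.1) (w e.1)) (fiberCell f (B e.2) (w e.2)) := by
    intro w hw
    rw [mem_piFinset] at hw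
    have := hstar V G (fun i => fiberCell f (B i) (w i))
      (fun i => by
        have h1 := mul_le_mul_of_nonneg_left (hcellcard i (w i) (hw i)) hρs.le
        linarith [hA2 i])
      (fun C hC => hden C fun i => ⟨((hC i).1.trans (fiberCell_subset _ _ _)).trans (hBA i), by
        have h1 := mul_le_mul_of_nonneg_left (hcellcard i (w i) (hw i)) hρs.le
        linarith [(hC i).2]⟩)
    rwa [div_eq_mul_one_div, mul_comm] at this
  have hcsy : 0 < cs * y := by positivity
  have hpos : ∀ w ∈ piFinset B, ∀ e ∈ ltPairs n,
      0 < edgeDens G (fiberCell f (B e.1) (w e.1)) (fiberCell f (B e.2) (w e.2)) := by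
    intro w hw e he
    refine lt_of_le_of_ne (edgeDens_nonneg G _ _) fun h => ?_
    have h1 := hprod w hw
    rw [Finset.prod_eq_zero he h.symm] at h1
    linarith
  set q : Fin n → V → ℝ := fun j v => 2 * (relDegree G (A j) v + ξ) with hq
  have hqpos : ∀ j v, 0 < q j v := fun j v => by
    have := relDegree_nonneg G (A j) v
    simp only [hq]; linarith
  have hqle : ∀ i j, ∀ v ∈ B i, edgeDens G (fiberCell f (B i) v) (B j) ≤ q j v := by
    intro i j v hv
    refine (edgeDens_le_two_mul_of_card_le G (hBA j) (hBcard j)).trans ?_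
    have : edgeDens G (fiberCell f (B i) v) (A j) ≤ relDegree G (A j) v + ξ :=
      edgeDens_le_of_relDegree_le G ⟨v, mem_fiberCell.2 ⟨hv, rfl⟩⟩
        fun x hx => hfclose x v (mem_fiberCell.1 hx).2 j
    simp only [hq]; linarith
  -- The density of a pair of cells is bounded through degrees from either end; adding both
  -- estimates gives the factor 2.
  have hside : ∀ e ∈ ltPairs n,
      2 * ∑ w ∈ piFinset B, Real.log
        (edgeDens G (fiberCell f (B e.1) (w e.1)) (fiberCell f (B e.2) (w e.2))) ≤
      ∑ w ∈ piFinset B, (Real.log (q e.2 (w e.1)) + Real.log (q e.1 (w e.2))) := by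
    intro e he
    have hne : e.1 ≠ e.2 := by
      simp only [ltPairs, mem_filter] at he; exact he.2.ne
    have h1 := sum_log_edgeDens_cells_le G f B hBne hne (q e.2) (hqpos e.2)
      (fun w hw => hpos w hw e he) (hqle e.1 e.2)
    have h2 := sum_log_edgeDens_cells_le G f B hBne hne.symm (q e.1) (hqpos e.1)
      (fun w hw => by rw [edgeDens_comm]; exact hpos w hw e he) (hqle e.2 e.1)
    simp only [edgeDens_comm G (fiberCell f (B e.2) _)] at h2
    rw [Finset.sum_add_distrib]
    linarith
  have hvpos := boxVol_pos hBne
  have hlow : boxVol B * Real.log (cs * y) ≤ ∑ e ∈ ltPairs n, ∑ w ∈ piFinset B, Real.log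
      (edgeDens G (fiberCell f (B e.1) (w e.1)) (fiberCell f (B e.2) (w e.2))) := by
    rw [Finset.sum_comm, ← card_piFinset_eq_boxVol, ← nsmul_eq_mul]
    refine Finset.card_nsmul_le_sum _ _ _ fun w hw => ?_
    rw [← Real.log_prod fun e he => (hpos w hw e he).ne']
    exact Real.log_le_log hcsy (hprod w hw)
  have hup : ∑ e ∈ ltPairs n, ∑ w ∈ piFinset B,
      (Real.log (q e.2 (w e.1)) + Real.log (q e.1 (w e.2))) ≤
        boxVol B * (n * Real.log (2 ^ n * p)) := by
    rw [Finset.sum_comm, ← card_piFinset_eq_boxVol, ← nsmul_eq_mul]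
    refine Finset.sum_le_card_nsmul _ _ _ fun w hw => ?_
    rw [mem_piFinset] at hw
    rw [sum_ltPairs_add_swap fun i j => Real.log (q j (w i))]
    -- The doubled degrees in `q` give 2^(n−1), and the degree product plus rounding error is at
    -- most 2p.
    have : ∀ i ∈ (Finset.univ : Finset (Fin n)),
        ∑ j ∈ Finset.univ.erase i, Real.log (q j (w i)) ≤ Real.log (2 ^ n * p) := by
      intro i _
      rw [← Real.log_prod fun j _ => (hqpos j (w i)).ne']
      refine Real.log_le_log (Finset.prod_pos fun j _ => hqpos j (w i)) ?_
      have h1 := hcon i (w i) (hBA i (hw i))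
      have h2 := prod_add_le_prod_add (Finset.univ.erase i) (fun j => relDegree G (A j) (w i))
        (fun j => relDegree_nonneg G _ _) (fun j => relDegree_le_one G _ _) hξpos.le hξ1
      have h3 : #(Finset.univ.erase i) = n - 1 := by simp
      simp only [hq]
      rw [Finset.prod_mul_distrib, Finset.prod_const]
      rw [h3] at h2 ⊢
      have h4 : (2 : ℝ) ^ n = 2 ^ (n - 1) * 2 := by
        rw [← pow_succ]; congr 1; omega
      have h5 : (2 ^ (n - 1) - 1) * ξ ≤ p := by
        have h6 : (2 : ℝ) ^ n * ξ = p := by rw [hξ]; field_simp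
        have h7 : (0 : ℝ) < 2 ^ (n - 1) := by positivity
        nlinarith
      rw [h4, mul_assoc]
      refine mul_le_mul_of_nonneg_left ?_ (by positivity)
      linarith
    have h8 := Finset.sum_le_card_nsmul _ _ _ this
    simpa using h8
  have hfin : 2 * Real.log (cs * y) ≤ n * Real.log (2 ^ n * p) := by
    have h1 := Finset.sum_le_sum hside
    rw [← Finset.mul_sum] at h1
    refine le_of_mul_le_mul_left ?_ hvpos
    linarith
  have hn0 : (n : ℝ) ≠ 0 := by exact_mod_cast (by omega : n ≠ 0)
  have hlogp : n * Real.log (2 ^ n * p) = n * Real.log (cs ^ 2 / 2) + 2 * Real.log y := by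
    have h1 : (2 : ℝ) ^ n * p = cs ^ 2 / 2 * y ^ ((2 : ℝ) / n) := by
      rw [hp, ← hdc, pow_succ]; ring
    rw [h1, Real.log_mul (by positivity) (by positivity), Real.log_rpow hy]
    field_simp
  have e1 : Real.log (cs * y) = Real.log cs + Real.log y := Real.log_mul hcspos.ne' hy.ne'
  have e2 : Real.log (cs ^ 2 / 2) = 2 * Real.log cs - Real.log 2 := by
    rw [Real.log_div (by positivity) (by norm_num), Real.log_pow]; norm_num
  -- What remains is 2 log cs ≤ 2n log cs − n log 2, impossible since log cs ≤ 0 and n ≥ 1.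
  rw [hlogp, e1, e2] at hfin
  have h1 : Real.log cs ≤ 0 := Real.log_nonpos hcspos.le hcs1
  have h2 : (1 : ℝ) ≤ n := by exact_mod_cast hn
  have h3 : 0 < Real.log 2 := Real.log_pos (by norm_num)
  nlinarith

end LargeDegrees

/-! ### Subboxes of a maximal box inherit its density. -/

section Maximal
open scoped Classical
open Finset Fintype

variable {ι V : Type*} [Fintype ι] [DecidableEq ι] (G : SimpleGraph V)

theorem boxVol_update (A : ι → Finset V) (i : ι) (S : Finset V) :
    boxVol (Function.update A i S) * #(A i) = boxVol A * #S := by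
  have h1 := Finset.mul_prod_erase Finset.univ (fun j => (#(A j) : ℝ)) (Finset.mem_univ i)
  have h2 := Finset.mul_prod_erase Finset.univ
    (fun j => (#(Function.update A i S j) : ℝ)) (Finset.mem_univ i)
  have h3 : ∏ j ∈ Finset.univ.erase i, (#(Function.update A i S j) : ℝ) =
      ∏ j ∈ Finset.univ.erase i, (#(A j) : ℝ) :=
    Finset.prod_congr rfl fun j hj => by rw [Function.update_of_ne (ne_of_mem_erase hj)]
  rw [h3, Function.update_self] at h2
  rw [boxVol, boxVol, ← h1, ← h2]
  ring

/-- A box contains subboxes of all smaller shapes with at most the same average. -/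
theorem exists_subbox_card_eq (B : ι → Finset V) (F : (ι → V) → ℝ) (m : ι → ℕ)
    (hm : ∀ i, 1 ≤ m i) (hmB : ∀ i, m i ≤ #(B i)) :
    ∃ D : ι → Finset V, (∀ i, D i ⊆ B i) ∧ (∀ i, #(D i) = m i) ∧
      (∑ w ∈ piFinset D, F w) * boxVol B ≤ (∑ w ∈ piFinset B, F w) * boxVol D := by
  suffices h : ∀ T : Finset ι, ∃ D : ι → Finset V, (∀ i, D i ⊆ B i) ∧ (∀ i ∈ T, #(D i) = m i) ∧
      (∀ i ∉ T, D i = B i) ∧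
      (∑ w ∈ piFinset D, F w) * boxVol B ≤ (∑ w ∈ piFinset B, F w) * boxVol D by
    obtain ⟨D, h1, h2, _, h4⟩ := h Finset.univ
    exact ⟨D, h1, fun i => h2 i (Finset.mem_univ i), h4⟩
  intro T
  induction T using Finset.induction_on with
  | empty => exact ⟨B, fun _ => Subset.rfl, by simp, fun _ _ => rfl, le_rfl⟩
  | insert i T hi ih =>
    obtain ⟨D, h1, h2, h3, h4⟩ := ih
    have hDi : D i = B i := h3 i hi
    obtain ⟨S, hS, hSc, hSle⟩ := exists_subset_card_eq_sum_le (D i)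
      (fun x => ∑ w ∈ piFinset D, F (Function.update w i x)) (hm i) (by rw [hDi]; exact hmB i)
    have hpos : (0 : ℝ) < #(D i) := by
      rw [hDi]; exact_mod_cast (hm i).trans (hmB i)
    rw [Finset.sum_comm, sum_piFinset_resample_subset, Finset.sum_comm, sum_piFinset_resample,
      ← hSc] at hSle
    refine ⟨Function.update D i S, ?_, ?_, ?_, ?_⟩
    · intro j
      by_cases hj : j = i
      · subst hj; rw [Function.update_self]; exact hS.trans (h1 j)
      · rw [Function.update_of_ne hj]; exact h1 j
    · intro j hj
      by_cases hji : j = i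
      · subst hji; rw [Function.update_self]; exact hSc
      · rw [Function.update_of_ne hji]; exact h2 j ((mem_insert.1 hj).resolve_left hji)
    · intro j hj
      rw [mem_insert, not_or] at hj
      rw [Function.update_of_ne hj.1]; exact h3 j hj.2
    · have hv := boxVol_update D i S
      have h5 : #(D i) * ∑ w ∈ piFinset (Function.update D i S), F w ≤
          #S * ∑ w ∈ piFinset D, F w := by
        refine le_of_mul_le_mul_left ?_ hpos
        linarith
      refine le_of_mul_le_mul_left ?_ hpos
      calc #(D i) * ((∑ w ∈ piFinset (Function.update D i S), F w) * boxVol B)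
          = (#(D i) * ∑ w ∈ piFinset (Function.update D i S), F w) * boxVol B := by ring
        _ ≤ (#S * ∑ w ∈ piFinset D, F w) * boxVol B :=
          mul_le_mul_of_nonneg_right h5 (boxVol_nonneg B)
        _ = #S * ((∑ w ∈ piFinset D, F w) * boxVol B) := by ring
        _ ≤ #S * ((∑ w ∈ piFinset B, F w) * boxVol D) :=
          mul_le_mul_of_nonneg_left h4 (Nat.cast_nonneg _)
        _ = #(D i) * ((∑ w ∈ piFinset B, F w) * boxVol (Function.update D i S)) := by
          linear_combination (-(∑ w ∈ piFinset B, F w)) * hv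

theorem exists_subbox_cliqueDens_le (B : ι → Finset V) (m : ι → ℕ)
    (hm : ∀ i, 1 ≤ m i) (hmB : ∀ i, m i ≤ #(B i)) :
    ∃ D : ι → Finset V, (∀ i, D i ⊆ B i) ∧ (∀ i, #(D i) = m i) ∧
      cliqueDens G D ≤ cliqueDens G B := by
  obtain ⟨D, h1, h2, h3⟩ := exists_subbox_card_eq B
    (fun w => if IsCliqueTuple G w then (1 : ℝ) else 0) m hm hmB
  refine ⟨D, h1, h2, ?_⟩
  rw [cliqueDens, cliqueDens, div_le_div_iff₀
    (boxVol_pos fun i => card_pos.1 (by have := h2 i; have := hm i; omega))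
    (boxVol_pos fun i => card_pos.1 (by have := hmB i; have := hm i; omega))]
  exact h3

theorem exists_subbox_le_cliqueDens (B : ι → Finset V) (m : ι → ℕ)
    (hm : ∀ i, 1 ≤ m i) (hmB : ∀ i, m i ≤ #(B i)) :
    ∃ D : ι → Finset V, (∀ i, D i ⊆ B i) ∧ (∀ i, #(D i) = m i) ∧
      cliqueDens G B ≤ cliqueDens G D := by
  obtain ⟨D, h1, h2, h3⟩ := exists_subbox_card_eq B
    (fun w => -(if IsCliqueTuple G w then (1 : ℝ) else 0)) m hm hmB
  refine ⟨D, h1, h2, ?_⟩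
  rw [cliqueDens, cliqueDens, div_le_div_iff₀
    (boxVol_pos fun i => card_pos.1 (by have := hmB i; have := hm i; omega))
    (boxVol_pos fun i => card_pos.1 (by have := h2 i; have := hm i; omega))]
  simp only [sum_neg_distrib, neg_mul, neg_le_neg_iff] at h3
  exact h3

/-- The box obtained from `D` by passing to the complement in the coordinates in `S`. -/
noncomputable def flipBox (A D : ι → Finset V) (S : Finset ι) : ι → Finset V :=
  fun i => if i ∈ S then A i \ D i else D i

theorem sum_flipBox {A D : ι → Finset V} (hD : ∀ i, D i ⊆ A i) (F : (ι → V) → ℝ) :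
    ∑ S : Finset ι, ∑ w ∈ piFinset (flipBox A D S), F w = ∑ w ∈ piFinset A, F w := by
  rw [← Finset.sum_fiberwise (piFinset A) (fun w => Finset.univ.filter fun i => w i ∉ D i) F]
  refine Finset.sum_congr rfl fun S _ => Finset.sum_congr ?_ fun _ _ => rfl
  ext w
  simp only [mem_piFinset, mem_filter, flipBox]
  constructor
  · intro h
    refine ⟨fun i => ?_, ?_⟩
    · have := h i
      split_ifs at this
      · exact (mem_sdiff.1 this).1
      · exact hD i this
    · ext i
      have := h i
      by_cases hi : i ∈ S
      · rw [if_pos hi] at this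
        simp [hi, (mem_sdiff.1 this).2]
      · rw [if_neg hi] at this
        simp [hi, this]
  · rintro ⟨h1, rfl⟩ i
    by_cases hi : w i ∈ D i
    · simp [hi]
    · simp [hi, h1 i]

/-- If a box maximises `log vol - b / density` among its subboxes, then its clique density is nearly
inherited by all subboxes that are not too small. -/
theorem le_cliqueDens_of_maximal {A D : ι → Finset V} {b μ : ℝ} (hb : 0 < b) (hμ : 0 < μ)
    (hA : 0 < cliqueSum G A)
    (hmax : ∀ E : ι → Finset V, (∀ i, E i ⊆ A i) → 0 < cliqueSum G E →
      Real.log (boxVol E) - b / cliqueDens G E ≤ Real.log (boxVol A) - b / cliqueDens G A)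
    (hD : ∀ i, D i ⊆ A i) (hD1 : ∀ i, (D i).Nonempty) (hD2 : ∀ i, 2 * #(D i) ≤ #(A i))
    (hvol : μ * boxVol A ≤ boxVol D)
    (hs : Real.log (1 / μ) * cliqueDens G A / b ≤ μ / 2) :
    cliqueDens G A * (1 - Real.log (1 / μ) * cliqueDens G A / b / μ) ≤ cliqueDens G D := by
  set y := cliqueDens G A with hy
  set θ : ℝ := Real.log (1 / μ) * y / b with hθ
  have hvA : 0 < boxVol A := hA.trans_le (cliqueSum_le_boxVol G A)
  have hvD : 0 < boxVol D := boxVol_pos hD1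
  have hypos : 0 < y := div_pos hA hvA
  have hDA : boxVol D ≤ boxVol A := Finset.prod_le_prod (fun _ _ => by positivity)
    fun i _ => by exact_mod_cast card_le_card (hD i)
  have hμ1 : μ ≤ 1 := by
    by_contra! h
    nlinarith
  have hlog : 0 ≤ Real.log (1 / μ) := Real.log_nonneg (by rw [le_div_iff₀ hμ]; linarith)
  have hθ0 : 0 ≤ θ := by positivity
  have hθ1 : θ ≤ 1 / 2 := by linarith
  -- No subbox of volume at least `μ * boxVol A` is denser than `Y`: the gain in −b/density would
  -- exceed the loss log(1/μ) in log-volume.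
  set Y : ℝ := y / (1 - θ) with hY
  have hYpos : 0 < Y := div_pos hypos (by linarith)
  have hyY : y ≤ Y := by rw [hY, le_div_iff₀ (by linarith)]; nlinarith
  have hflip_sub : ∀ S i, flipBox A D S i ⊆ A i := by
    intro S i
    unfold flipBox
    split_ifs
    · exact sdiff_subset
    · exact hD i
  have hflip_vol : ∀ S, boxVol D ≤ boxVol (flipBox A D S) := by
    intro S
    refine Finset.prod_le_prod (fun _ _ => by positivity) fun i _ => ?_
    unfold flipBox
    split_ifs
    · have h1 := card_sdiff_of_subset (hD i)
      have h2 := hD2 i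
      exact_mod_cast (by omega : #(D i) ≤ #(A i \ D i))
    · exact le_rfl
  have hub : ∀ S, cliqueSum G (flipBox A D S) ≤ Y * boxVol (flipBox A D S) := by
    intro S
    have hvE : 0 < boxVol (flipBox A D S) := hvD.trans_le (hflip_vol S)
    rcases (cliqueSum_nonneg G (flipBox A D S)).eq_or_lt with h | h
    · rw [← h]; positivity
    · have h1 := hmax _ (hflip_sub S) h
      have h2 : Real.log (boxVol A) - Real.log (boxVol (flipBox A D S)) ≤ Real.log (1 / μ) := by
        have h3 : Real.log (μ * boxVol A) ≤ Real.log (boxVol (flipBox A D S)) :=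
          Real.log_le_log (by positivity) (hvol.trans (hflip_vol S))
        rw [Real.log_mul hμ.ne' hvA.ne'] at h3
        rw [one_div, Real.log_inv]
        linarith
      have hyE : 0 < cliqueDens G (flipBox A D S) := div_pos h hvE
      have h4 : b / y - b / cliqueDens G (flipBox A D S) ≤ Real.log (1 / μ) := by linarith
      have h5 : b * (1 - θ) / y ≤ b / cliqueDens G (flipBox A D S) := by
        have h6 : b * (1 - θ) / y = b / y - Real.log (1 / μ) := by
          rw [hθ]; field_simp
        rw [h6]; linarith
      rw [div_le_div_iff₀ hypos hyE] at h5
      have h7 : cliqueDens G (flipBox A D S) ≤ Y := by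
        rw [hY, le_div_iff₀ (by linarith)]
        refine le_of_mul_le_mul_left ?_ hb
        linarith
      rwa [cliqueDens, div_le_iff₀ hvE] at h7
  have hsum1 : ∑ S : Finset ι, cliqueSum G (flipBox A D S) = cliqueSum G A :=
    sum_flipBox hD fun w => if IsCliqueTuple G w then (1 : ℝ) else 0
  have hsum2 : ∑ S : Finset ι, boxVol (flipBox A D S) = boxVol A := by
    have := sum_flipBox hD fun _ => (1 : ℝ)
    simpa only [Finset.sum_const, nsmul_eq_mul, mul_one, card_piFinset_eq_boxVol] using this
  have hempty : flipBox A D ∅ = D := by funext i; simp [flipBox]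
  -- The flips partition `A`, and by `hD2` none has smaller volume than `D`. All flips other than
  -- `D` have density at most `Y`, so `D` must carry the remaining cliques.
  rw [← Finset.add_sum_erase Finset.univ _ (Finset.mem_univ ∅), hempty] at hsum1 hsum2
  have hrest : ∑ S ∈ Finset.univ.erase ∅, cliqueSum G (flipBox A D S) ≤
      Y * (boxVol A - boxVol D) := by
    rw [← hsum2, add_sub_cancel_left, Finset.mul_sum]
    exact Finset.sum_le_sum fun S _ => hub S
  have hAeq : cliqueSum G A = y * boxVol A := by rw [hy, cliqueDens, div_mul_cancel₀ _ hvA.ne']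
  have hmain : (Y - (Y - y) / μ) * boxVol D ≤ cliqueSum G D := by
    have h1 : (Y - y) * boxVol A ≤ (Y - y) / μ * boxVol D := by
      rw [div_mul_eq_mul_div, le_div_iff₀ hμ]
      nlinarith [mul_le_mul_of_nonneg_left hvol (sub_nonneg.2 hyY)]
    nlinarith
  rw [cliqueDens, le_div_iff₀ hvD]
  refine le_trans (mul_le_mul_of_nonneg_right ?_ hvD.le) hmain
  have h1 : Y - (Y - y) / μ = Y * (1 - θ / μ) := by
    have : y = Y * (1 - θ) := by rw [hY, div_mul_cancel₀ _ (by linarith : (1 - θ) ≠ 0)]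
    rw [this]; field_simp; ring
  rw [h1]
  refine mul_le_mul_of_nonneg_right hyY ?_
  rw [sub_nonneg, div_le_one hμ]
  linarith

end Maximal

/-! ### Moving to the neighbourhood of a vertex at bounded cost. -/

section Step
open scoped Classical
open Finset Fintype

/-- Half of `A` is the largest part size `le_cliqueDens_of_maximal` allows; the factor 3 covers
rounding. -/
theorem exists_subset_half {V : Type*} {S A : Finset V} (hA : 2 ≤ #A) (hS : S.Nonempty)
    (hSA : S ⊆ A) : ∃ D ⊆ S, D.Nonempty ∧ 2 * #D ≤ #A ∧ #S ≤ 3 * #D := by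
  have h1 := hS.card_pos
  have h2 := card_le_card hSA
  obtain ⟨D, hD, _⟩ := exists_subset_card_eq (s := S) (n := min #S (#A / 2)) (min_le_left _ _)
  refine ⟨D, hD, card_pos.1 ?_, ?_, ?_⟩ <;> omega

theorem pow_mul_boxVol_le {ι V : Type*} [Fintype ι] {A D : ι → Finset V} (c : ℝ)
    (p : ι → ℝ) (hp : ∀ i, 0 ≤ p i) (h : ∀ i, p i * #(A i) ≤ c * #(D i)) :
    (∏ i, p i) * boxVol A ≤ c ^ Fintype.card ι * boxVol D := by
  calc (∏ i, p i) * boxVol A = ∏ i, p i * #(A i) := by rw [boxVol, Finset.prod_mul_distrib]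
    _ ≤ ∏ i, c * (#(D i) : ℝ) :=
      Finset.prod_le_prod (fun i _ => mul_nonneg (hp i) (by positivity)) fun i _ => h i
    _ = _ := by rw [Finset.prod_mul_distrib, Finset.prod_const, boxVol, Finset.card_univ]

/-- From a maximal box we can move to the neighbourhood of a suitable vertex, without losing much
in size and density. -/
theorem exists_step {n : ℕ} {V : Type*} (G : SimpleGraph V) (A : Fin n → Finset V)
    {b γ ρ p μ₀ μ₁ : ℝ} (hb : 0 < b) (hγ : 0 < γ) (hρ : 0 < ρ) (hρ1 : ρ ≤ 1) (hp : 0 < p)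
    (hp1 : p ≤ 1) (hμ₀ : μ₀ = p / 3 ^ n) (hμ₁ : μ₁ = (ρ / 3) ^ n)
    (hA : 0 < cliqueSum G A) (hden : γ / 2 ≤ cliqueDens G A)
    (hmax : ∀ E : Fin n → Finset V, (∀ i, E i ⊆ A i) → 0 < cliqueSum G E →
      Real.log (boxVol E) - b / cliqueDens G E ≤ Real.log (boxVol A) - b / cliqueDens G A)
    (hA2 : ∀ i, 2 ≤ ρ * #(A i))
    (hvertex : (∀ B : Fin n → Finset V, (∀ i, B i ⊆ A i ∧ ρ * #(A i) ≤ #(B i)) →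
        γ / 4 ≤ cliqueDens G B) →
      ∃ i, ∃ v ∈ A i, p ≤ ∏ j ∈ Finset.univ.erase i, relDegree G (A j) v)
    (hc0 : Real.log (1 / μ₀) / b ≤ μ₀ / 2) (hc1 : Real.log (1 / μ₁) / b ≤ μ₁ / 2) :
    ∃ i, ∃ v ∈ A i, ∃ D : Fin n → Finset V, (∀ j, D j ⊆ A j) ∧ v ∉ D i ∧
      (∀ j, j ≠ i → ∀ x ∈ D j, G.Adj v x) ∧ 0 < cliqueSum G D ∧
      Real.log (boxVol A) - b / cliqueDens G A - (3 * Real.log (1 / μ₀) / μ₀) ≤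
        Real.log (boxVol D) - b / cliqueDens G D := by
  set y := cliqueDens G A with hy
  have hypos : 0 < y := by linarith
  have hy1 : y ≤ 1 := cliqueDens_le_one G A
  have hvA : 0 < boxVol A := hA.trans_le (cliqueSum_le_boxVol G A)
  have hAcard : ∀ i, 2 ≤ #(A i) := fun i => by
    have : (2 : ℝ) ≤ #(A i) :=
      (hA2 i).trans (mul_le_of_le_one_left (by positivity) hρ1)
    exact_mod_cast this
  have hμ₀pos : 0 < μ₀ := by rw [hμ₀]; positivity
  have hμ₁pos : 0 < μ₁ := by rw [hμ₁]; positivity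
  have hμ₀1 : μ₀ ≤ 1 := by
    rw [hμ₀]; exact div_le_one_of_le₀ (hp1.trans (one_le_pow₀ (by norm_num))) (by positivity)
  have hμ₁1 : μ₁ ≤ 1 := by
    rw [hμ₁]; exact pow_le_one₀ (by positivity) (by linarith)
  have hlog : ∀ μ : ℝ, 0 < μ → μ ≤ 1 → 0 ≤ Real.log (1 / μ) := fun μ h1 h2 =>
    Real.log_nonneg (by rw [le_div_iff₀ h1]; linarith)
  have hθ : ∀ μ : ℝ, 0 < μ → μ ≤ 1 → Real.log (1 / μ) / b ≤ μ / 2 →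
      Real.log (1 / μ) * y / b ≤ μ / 2 := by
    intro μ h1 h2 h3
    refine le_trans ?_ h3
    exact div_le_div_of_nonneg_right (mul_le_of_le_one_right (hlog μ h1 h2) hy1) hb.le
  have hlower : ∀ B : Fin n → Finset V, (∀ i, B i ⊆ A i ∧ ρ * #(A i) ≤ #(B i)) →
      γ / 4 ≤ cliqueDens G B := by
    intro B hB
    have hBne : ∀ i, (B i).Nonempty := fun i => by
      have : (0 : ℝ) < #(B i) := by linarith [(hB i).2, hA2 i]
      exact card_pos.1 (by exact_mod_cast this)
    -- Cutting each part to at most half of `A i`, without raising the density, makes maximality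
    -- applicable. It loses at most a factor 2, whence γ/4 from γ/2.
    obtain ⟨D, hD1, hD2, hD3⟩ := exists_subbox_cliqueDens_le G B
      (fun i => min #(B i) (#(A i) / 2))
      (fun i => by have := (hBne i).card_pos; have := hAcard i; omega)
      (fun i => min_le_left _ _)
    refine le_trans ?_ hD3
    have hvol : μ₁ * boxVol A ≤ boxVol D := by
      have h1 := pow_mul_boxVol_le (A := A) (D := D) 3 (fun _ => ρ)
        (fun _ => hρ.le) (fun i => by
          refine (hB i).2.trans ?_
          have h2 := hD2 i
          have h3 := hAcard i
          have h4 := card_le_card (hB i).1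
          exact_mod_cast (by omega : #(B i) ≤ 3 * #(D i)))
      rw [Finset.prod_const, Finset.card_univ, Fintype.card_fin] at h1
      rw [hμ₁, div_pow, div_mul_eq_mul_div, div_le_iff₀ (by positivity)]
      linarith
    have h := le_cliqueDens_of_maximal G hb hμ₁pos hA hmax (fun i => (hD1 i).trans (hB i).1)
      (fun i => card_pos.1 (by
        have := hD2 i; have := (hBne i).card_pos; have := hAcard i; omega))
      (fun i => by have := hD2 i; omega) hvol (hθ μ₁ hμ₁pos hμ₁1 hc1)
    have h5 : Real.log (1 / μ₁) * y / b / μ₁ ≤ 1 / 2 := by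
      rw [div_le_iff₀ hμ₁pos]; linarith [hθ μ₁ hμ₁pos hμ₁1 hc1]
    rw [← hy] at h
    nlinarith
  obtain ⟨i, v, hv, hprod⟩ := hvertex hlower
  -- The part of `v` is halved with `v` removed; every other part is cut down to neighbours of `v`,
  -- at most half of the part.
  have hex : ∀ j, ∃ D : Finset V, D ⊆ A j ∧ D.Nonempty ∧ 2 * #D ≤ #(A j) ∧
      (j = i → v ∉ D ∧ 1 * (#(A j) : ℝ) ≤ 3 * #D) ∧
      (j ≠ i → (∀ x ∈ D, G.Adj v x) ∧ relDegree G (A j) v * #(A j) ≤ 3 * #D) := by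
    intro j
    by_cases hj : j = i
    · subst hj
      obtain ⟨D, hD, hc⟩ := exists_subset_card_eq (s := (A j).erase v) (n := #(A j) / 2)
        (by rw [card_erase_of_mem hv]; have := hAcard j; omega)
      have := hAcard j
      refine ⟨D, hD.trans (erase_subset _ _), card_pos.1 (by omega), by omega, fun _ =>
        ⟨fun h => by simpa using hD h, ?_⟩, fun h => absurd rfl h⟩
      rw [one_mul]
      exact_mod_cast (by omega : #(A j) ≤ 3 * #D)
    · have hpos : 0 < relDegree G (A j) v := by
        refine lt_of_le_of_ne (relDegree_nonneg G _ _) fun h => ?_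
        rw [Finset.prod_eq_zero (Finset.mem_erase.2 ⟨hj, Finset.mem_univ j⟩) h.symm] at hprod
        linarith
      have hcard0 : (0 : ℝ) < #(A j) := by
        exact_mod_cast (by have := hAcard j; omega : 0 < #(A j))
      have heq : relDegree G (A j) v * #(A j) = #((A j).filter fun x => G.Adj v x) := by
        rw [relDegree, div_mul_cancel₀ _ hcard0.ne']
      have hne : ((A j).filter fun x => G.Adj v x).Nonempty := by
        rw [← card_pos]
        have := mul_pos hpos hcard0
        rw [heq] at this
        exact_mod_cast this
      obtain ⟨D, h1, h2, h3, h4⟩ := exists_subset_half (hAcard j) hne (filter_subset _ _)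
      refine ⟨D, h1.trans (filter_subset _ _), h2, h3, fun h => absurd h hj, fun _ =>
        ⟨fun x hx => (mem_filter.1 (h1 hx)).2, ?_⟩⟩
      rw [heq]; exact_mod_cast h4
  choose D hD1 hD2 hD3 hD4 hD5 using hex
  have hvol : μ₀ * boxVol A ≤ boxVol D := by
    have h1 := pow_mul_boxVol_le (A := A) (D := D) 3
      (fun j => if j = i then 1 else relDegree G (A j) v)
      (fun j => by
        split_ifs
        · norm_num
        · exact relDegree_nonneg G _ _)
      (fun j => by
        by_cases hj : j = i
        · rw [if_pos hj]; exact (hD4 j hj).2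
        · rw [if_neg hj]; exact (hD5 j hj).2)
    have h2 : ∏ j, (if j = i then 1 else relDegree G (A j) v) =
        ∏ j ∈ Finset.univ.erase i, relDegree G (A j) v := by
      rw [← Finset.mul_prod_erase Finset.univ _ (Finset.mem_univ i), if_pos rfl, one_mul]
      exact Finset.prod_congr rfl fun j hj => if_neg (ne_of_mem_erase hj)
    rw [h2, Fintype.card_fin] at h1
    rw [hμ₀, div_mul_eq_mul_div, div_le_iff₀ (by positivity)]
    nlinarith [mul_le_mul_of_nonneg_right hprod hvA.le]
  have hlow := le_cliqueDens_of_maximal G hb hμ₀pos hA hmax hD1 hD2 hD3 hvol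
    (hθ μ₀ hμ₀pos hμ₀1 hc0)
  rw [← hy] at hlow
  set t : ℝ := Real.log (1 / μ₀) * y / b / μ₀ with ht
  have hl0 := hlog μ₀ hμ₀pos hμ₀1
  have ht0 : 0 ≤ t := by positivity
  have ht1 : t ≤ 1 / 2 := by
    rw [ht, div_le_iff₀ hμ₀pos]; linarith [hθ μ₀ hμ₀pos hμ₀1 hc0]
  have hyD : 0 < cliqueDens G D := lt_of_lt_of_le (mul_pos hypos (by linarith)) hlow
  have hvD : 0 < boxVol D := boxVol_pos hD2
  refine ⟨i, v, hv, D, hD1, (hD4 i rfl).1, fun j hj => (hD5 j hj).1, ?_, ?_⟩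
  · rw [cliqueDens] at hyD
    exact (div_pos_iff_of_pos_right hvD).1 hyD
  -- The density term costs at most 2 log(1/μ₀)/μ₀ and the log-volume at most log(1/μ₀) ≤
  -- log(1/μ₀)/μ₀.
  · have h1 : b / cliqueDens G D ≤ b / y + 2 * Real.log (1 / μ₀) / μ₀ := by
      have h2 : b / cliqueDens G D ≤ b / (y * (1 - t)) :=
        div_le_div_of_nonneg_left hb.le (mul_pos hypos (by linarith)) hlow
      have h3 : b / (y * (1 - t)) ≤ b / y * (1 + 2 * t) := by
        rw [div_mul_eq_mul_div, div_le_div_iff₀ (mul_pos hypos (by linarith)) hypos]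
        have h4 : 1 ≤ (1 + 2 * t) * (1 - t) := by nlinarith
        have h5 : 0 < b * y := by positivity
        nlinarith
      have h6 : b / y * (1 + 2 * t) = b / y + 2 * Real.log (1 / μ₀) / μ₀ := by
        rw [ht]; field_simp
      linarith
    have h2 : Real.log (boxVol A) - Real.log (boxVol D) ≤ Real.log (1 / μ₀) := by
      have h3 := Real.log_le_log (by positivity) hvol
      rw [Real.log_mul hμ₀pos.ne' hvA.ne'] at h3
      rw [one_div, Real.log_inv]
      linarith
    have h3 : Real.log (1 / μ₀) ≤ Real.log (1 / μ₀) / μ₀ := by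
      rw [le_div_iff₀ hμ₀pos]; nlinarith
    have h4 : 3 * Real.log (1 / μ₀) / μ₀ =
        Real.log (1 / μ₀) / μ₀ + 2 * Real.log (1 / μ₀) / μ₀ := by ring
    rw [h4]
    linarith

end Step

/-! ### The potential argument. -/

section Core
open scoped Classical
open Finset Fintype

universe u

/-- The states of the extremal argument: vertices of `T i` are adjacent to all vertices of `A j` for
`j ≠ i`, and the box `A` contains a clique. -/
def IsCompleteState {n : ℕ} {V : Type*} (G : SimpleGraph V)
    (s : (Fin n → Finset V) × (Fin n → Finset V)) : Prop :=
  (∀ i j, i ≠ j → ∀ v ∈ s.1 i, ∀ x ∈ s.2 j, G.Adj v x) ∧ (∀ i, Disjoint (s.1 i) (s.2 i)) ∧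
    0 < cliqueSum G s.2

/-- A potential argument: if boxes that are optimal, large and dense allow a step of bounded cost,
then there is a state with many chosen vertices and a large, dense box. -/
theorem exists_completeState {n : ℕ} (hn : 1 ≤ n) {V : Type*} [Fintype V] (G : SimpleGraph V)
    {γ β α : ℝ} (hγ : 0 < γ) (hβ : 0 < β) (hα : 0 < α) (τ : ℕ) (hτ : α * τ ≤ β)
    (hN : 0 < Fintype.card V)
    (hG : γ * (Fintype.card V : ℝ) ^ n ≤ cliqueSum G fun _ : Fin n => (Finset.univ : Finset V))
    (hstep : ∀ A : Fin n → Finset V, 0 < cliqueSum G A → γ / 2 ≤ cliqueDens G A →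
      (∀ j, Real.log (Fintype.card V) - 2 * β ≤ Real.log #(A j)) →
      (∀ E : Fin n → Finset V, (∀ i, E i ⊆ A i) → 0 < cliqueSum G E →
        Real.log (boxVol E) - β * γ / cliqueDens G E ≤
          Real.log (boxVol A) - β * γ / cliqueDens G A) →
      ∃ i, ∃ v ∈ A i, ∃ D : Fin n → Finset V, (∀ j, D j ⊆ A j) ∧ v ∉ D i ∧
        (∀ j, j ≠ i → ∀ x ∈ D j, G.Adj v x) ∧ 0 < cliqueSum G D ∧
        Real.log (boxVol A) - β * γ / cliqueDens G A - α <
          Real.log (boxVol D) - β * γ / cliqueDens G D) :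
    ∃ s : (Fin n → Finset V) × (Fin n → Finset V), IsCompleteState G s ∧
      ∑ i, #(s.1 i) = τ ∧ γ / 2 ≤ cliqueDens G s.2 ∧
      ∀ j, Real.log (Fintype.card V) - 2 * β ≤ Real.log #(s.2 j) := by
  set N : ℝ := (Fintype.card V : ℝ) with hNdef
  have hNpos : 0 < N := by rw [hNdef]; exact_mod_cast hN
  set b : ℝ := β * γ with hb
  have hbpos : 0 < b := by positivity
  set U : Fin n → Finset V := fun _ => Finset.univ with hU
  have hvU : boxVol U = N ^ n := by simp [hU, boxVol, hNdef, Finset.card_univ]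
  have hUpos : 0 < cliqueSum G U := lt_of_lt_of_le (by positivity) hG
  have hUden : γ ≤ cliqueDens G U := by
    rw [cliqueDens, hvU, le_div_iff₀ (by positivity)]; exact hG
  set Ψ : (Fin n → Finset V) × (Fin n → Finset V) → ℝ := fun s =>
    α * (∑ i, #(s.1 i) : ℕ) + (Real.log (boxVol s.2) - b / cliqueDens G s.2) with hΨ
  set S : Finset ((Fin n → Finset V) × (Fin n → Finset V)) :=
    Finset.univ.filter fun s => IsCompleteState G s ∧ ∑ i, #(s.1 i) ≤ τ with hS
  have hinit : ((fun _ => ∅, U) : (Fin n → Finset V) × (Fin n → Finset V)) ∈ S := by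
    simp only [hS, mem_filter, Finset.mem_univ, true_and]
    exact ⟨⟨by simp, by simp, hUpos⟩, by simp⟩
  obtain ⟨s, hs, hmax⟩ := S.exists_max_image Ψ ⟨_, hinit⟩
  have hmem : ∀ s, s ∈ S ↔ IsCompleteState G s ∧ ∑ i, #(s.1 i) ≤ τ := fun s => by simp [hS]
  obtain ⟨⟨hadj, hdisj, hpos⟩, hsum⟩ := (hmem s).1 hs
  have hvs : 0 < boxVol s.2 := hpos.trans_le (cliqueSum_le_boxVol G s.2)
  have hys : 0 < cliqueDens G s.2 := div_pos hpos hvs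
  have hcardle : ∀ j, (#(s.2 j) : ℝ) ≤ N := fun j => by
    rw [hNdef]; exact_mod_cast card_le_univ _
  have hcardpos : ∀ j, (0 : ℝ) < #(s.2 j) := fun j => by
    refine lt_of_le_of_ne (by positivity) fun h => ?_
    rw [boxVol, Finset.prod_eq_zero (Finset.mem_univ j) h.symm] at hvs
    exact lt_irrefl _ hvs
  have hvle : ∀ j, boxVol s.2 ≤ #(s.2 j) * N ^ (n - 1) := by
    intro j
    rw [boxVol, ← Finset.mul_prod_erase Finset.univ _ (Finset.mem_univ j)]
    refine mul_le_mul_of_nonneg_left ?_ (by positivity)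
    calc ∏ i ∈ Finset.univ.erase j, (#(s.2 i) : ℝ) ≤ ∏ _i ∈ Finset.univ.erase j, N :=
          Finset.prod_le_prod (fun _ _ => by positivity) fun i _ => hcardle i
      _ = N ^ (n - 1) := by simp
  have hlogv : ∀ j, Real.log (boxVol s.2) ≤ Real.log #(s.2 j) + (n - 1) * Real.log N := by
    intro j
    have h1 := Real.log_le_log hvs (hvle j)
    rw [Real.log_mul (hcardpos j).ne' (by positivity), Real.log_pow] at h1
    rwa [Nat.cast_sub hn, Nat.cast_one] at h1
  -- Initially the density is at least γ, so b/density is at most β. Since the chosen vertices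
  -- contribute at most β as well, a maximal state loses at most 2β in total, which bounds both its
  -- part sizes and its density.
  have hΨ0 : n * Real.log N - β ≤ Ψ s := by
    refine le_trans ?_ (hmax _ hinit)
    simp only [hΨ, hvU, Finset.card_empty, Finset.sum_const_zero, Nat.cast_zero, mul_zero, zero_add,
      Real.log_pow]
    have : b / cliqueDens G U ≤ β := by
      rw [div_le_iff₀ (hγ.trans_le hUden), hb]
      exact mul_le_mul_of_nonneg_left hUden hβ.le
    linarith
  have hατ : α * (∑ i, #(s.1 i) : ℕ) ≤ β :=
    (mul_le_mul_of_nonneg_left (by exact_mod_cast hsum) hα.le).trans hτ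
  have hby : 0 < b / cliqueDens G s.2 := by positivity
  have hsize : ∀ j, Real.log N - 2 * β ≤ Real.log #(s.2 j) := by
    intro j
    have h1 := hlogv j
    simp only [hΨ] at hΨ0
    linarith
  have hdens : γ / 2 ≤ cliqueDens G s.2 := by
    have h1 := hlogv ⟨0, hn⟩
    have h2 := Real.log_le_log (hcardpos ⟨0, hn⟩) (hcardle ⟨0, hn⟩)
    simp only [hΨ] at hΨ0
    have h3 : b / cliqueDens G s.2 ≤ 2 * β := by linarith
    rw [div_le_iff₀ hys, hb] at h3
    have h4 : β * γ ≤ β * (2 * cliqueDens G s.2) := by linarith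
    linarith [le_of_mul_le_mul_left h4 hβ]
  refine ⟨s, ⟨hadj, hdisj, hpos⟩, ?_, hdens, hsize⟩
  by_contra hne
  have hlt : ∑ i, #(s.1 i) < τ := lt_of_le_of_ne hsum hne
  -- With the chosen sets fixed, maximality of the state is maximality of its box among subboxes.
  -- The step then produces a state of larger potential, a contradiction.
  obtain ⟨i, v, hv, D, hD, hvD, hDadj, hDpos, hgain⟩ := hstep s.2 hpos hdens hsize (by
    intro E hE hEpos
    have h1 := hmax (s.1, E) ((hmem _).2 ⟨⟨fun i j hij v hv x hx => hadj i j hij v hv x (hE j hx),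
      fun i => (hdisj i).mono_right (hE i), hEpos⟩, hsum⟩)
    simp only [hΨ] at h1
    linarith)
  have hvT : v ∉ s.1 i := fun h => (Finset.disjoint_left.1 (hdisj i)) h hv
  set T' : Fin n → Finset V := Function.update s.1 i (insert v (s.1 i)) with hT'
  have hT'sum : ∑ j, #(T' j) = ∑ j, #(s.1 j) + 1 := by
    rw [← Finset.add_sum_erase Finset.univ _ (Finset.mem_univ i),
      ← Finset.add_sum_erase Finset.univ (fun j => #(s.1 j)) (Finset.mem_univ i)]
    have h1 : ∑ j ∈ Finset.univ.erase i, #(T' j) = ∑ j ∈ Finset.univ.erase i, #(s.1 j) :=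
      Finset.sum_congr rfl fun j hj => by rw [hT', Function.update_of_ne (ne_of_mem_erase hj)]
    rw [h1, hT', Function.update_self, card_insert_of_notMem hvT]
    ring
  have hstate : ((T', D) : (Fin n → Finset V) × (Fin n → Finset V)) ∈ S := by
    refine (hmem _).2 ⟨⟨?_, ?_, hDpos⟩, by simp only [hT'sum]; omega⟩
    · intro j l hjl u hu x hx
      by_cases hj : j = i
      · subst hj
        simp only [hT', Function.update_self, mem_insert] at hu
        rcases hu with rfl | hu
        · exact hDadj l hjl.symm x hx
        · exact hadj j l hjl u hu x (hD l hx)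
      · simp only [hT', Function.update_of_ne hj] at hu
        exact hadj j l hjl u hu x (hD l hx)
    · intro j
      by_cases hj : j = i
      · subst hj
        simp only [hT', Function.update_self, disjoint_insert_left]
        exact ⟨hvD, (hdisj j).mono_right (hD j)⟩
      · simp only [hT', Function.update_of_ne hj]
        exact (hdisj j).mono_right (hD j)
  have h1 := hmax _ hstate
  simp only [hΨ, hT'sum] at h1
  push_cast at h1
  linarith

/-- A graph with many cliques contains many vertices complete to a large box that still has many
cliques. -/
theorem exists_complete_to_box {n : ℕ} (hn : 2 ≤ n) :
    ∃ δ : ℝ, 0 < δ ∧ ∀ γ : ℝ, 0 < γ → γ ≤ 1 / 2 → ∀ᶠ N : ℕ in atTop,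
      ∀ (V : Type u) [Fintype V] (G : SimpleGraph V), Fintype.card V = N →
        γ * (N : ℝ) ^ n ≤ cliqueSum G (fun _ : Fin n => (Finset.univ : Finset V)) →
        ∃ (i : Fin n) (T : Finset V) (A : Fin n → Finset V),
          δ * (γ ^ ((2 : ℝ) / n) / Real.log (1 / γ)) * Real.log N ≤ #T ∧
          (∀ j, j ≠ i → ∀ v ∈ T, ∀ x ∈ A j, G.Adj v x) ∧
          (∀ j, Real.log N / 2 ≤ Real.log #(A j)) ∧ γ / 2 ≤ cliqueDens G A := by
  have hn0 : (0 : ℝ) < n := by exact_mod_cast (by omega : 0 < n)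
  -- Chosen so that μ₀ = c γ^(2/n).
  set c : ℝ := degreeConst n * (1 / 4) ^ ((2 : ℝ) / n) / 3 ^ n with hc
  have hcpos : 0 < c := by have := degreeConst_pos n; positivity
  have hdc1 : degreeConst n ≤ 1 := by
    unfold degreeConst
    rw [div_div]
    refine div_le_one_of_le₀ ?_ (by positivity)
    exact one_le_mul_of_one_le_of_one_le (one_le_pow₀ (one_le_pow₀ (by norm_num)))
      (one_le_pow₀ (by norm_num))
  have hc1 : c ≤ 1 := by
    rw [hc]
    refine div_le_one_of_le₀ (le_trans ?_ (one_le_pow₀ (by norm_num))) (by positivity)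
    exact mul_le_one₀ hdc1 (by positivity)
      (Real.rpow_le_one (by norm_num) (by norm_num) (by positivity))
  have hlog2 : 0 < Real.log 2 := Real.log_pos (by norm_num)
  -- Absorbs log(1/c) into a multiple of log(1/γ), which is at least log 2 because γ ≤ 1/2.
  set M : ℝ := Real.log (1 / c) / Real.log 2 + 1 with hM
  have hlc : 0 ≤ Real.log (1 / c) := Real.log_nonneg (by rw [le_div_iff₀ hcpos]; linarith)
  have hMpos : 0 < M := by positivity
  refine ⟨c / (32 * n * M), by positivity, ?_⟩
  intro γ hγ hγ1
  set p : ℝ := degreeConst n * (γ / 4) ^ ((2 : ℝ) / n) with hp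
  have hppos : 0 < p := mul_pos (degreeConst_pos n) (Real.rpow_pos_of_pos (by positivity) _)
  have hp1 : p ≤ 1 := mul_le_one₀ hdc1 (by positivity)
    (Real.rpow_le_one (by positivity) (by linarith) (by positivity))
  set μ₀ : ℝ := p / 3 ^ n with hμ₀
  have hμ₀pos : 0 < μ₀ := by positivity
  have hμ₀c : μ₀ = c * γ ^ ((2 : ℝ) / n) := by
    rw [hμ₀, hp, hc, div_eq_mul_one_div γ 4, Real.mul_rpow hγ.le (by norm_num)]
    ring
  have hl0 : 0 < Real.log (1 / μ₀) := by
    refine Real.log_pos ?_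
    rw [lt_div_iff₀ hμ₀pos, one_mul, hμ₀c]
    have : γ ^ ((2 : ℝ) / n) < 1 := Real.rpow_lt_one hγ.le (by linarith) (by positivity)
    nlinarith [Real.rpow_pos_of_pos hγ ((2 : ℝ) / n)]
  have hlγ : Real.log 2 ≤ Real.log (1 / γ) :=
    Real.log_le_log (by norm_num) (by rw [le_div_iff₀ hγ]; linarith)
  have hl0M : Real.log (1 / μ₀) ≤ M * Real.log (1 / γ) := by
    have h1 : Real.log (1 / μ₀) = Real.log (1 / c) + 2 / n * Real.log (1 / γ) := by
      simp only [one_div, Real.log_inv]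
      rw [hμ₀c, Real.log_mul hcpos.ne' (by positivity), Real.log_rpow hγ]
      ring
    have h2 : (2 : ℝ) / n ≤ 1 := by
      rw [div_le_one hn0]; exact_mod_cast hn
    have h3 : Real.log (1 / c) ≤ Real.log (1 / c) / Real.log 2 * Real.log (1 / γ) := by
      rw [div_mul_eq_mul_div, le_div_iff₀ hlog2]
      exact mul_le_mul_of_nonneg_left hlγ hlc
    rw [h1, hM]
    nlinarith
  -- More than the cost 3 log(1/μ₀)/μ₀ of a step, so each step gains strictly.
  set α : ℝ := 4 * Real.log (1 / μ₀) / μ₀ with hα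
  have hαpos : 0 < α := by positivity
  obtain ⟨ρ, hρ, hρ1, hvertex⟩ := exists_vertex_prod_relDegree.{u} (n := n) (by omega)
    (y := γ / 4) (by positivity) (by linarith)
  set μ₁ : ℝ := (ρ / 3) ^ n with hμ₁
  have hμ₁pos : 0 < μ₁ := by positivity
  have hlogN : Tendsto (fun N : ℕ => Real.log N) atTop atTop :=
    Real.tendsto_log_atTop.comp tendsto_natCast_atTop_atTop
  -- The first two thresholds make b = βγ large enough for both uses of maximality, the third makes
  -- parts of size √N exceed 2/ρ, and the fourth gives τ ≥ 1.
  filter_upwards [hlogN.eventually_ge_atTop (4 * (2 * Real.log (1 / μ₀) / (γ * μ₀))),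
    hlogN.eventually_ge_atTop (4 * (2 * Real.log (1 / μ₁) / (γ * μ₁))),
    hlogN.eventually_ge_atTop (2 * Real.log (2 / ρ)), hlogN.eventually_ge_atTop (4 * α),
    hlogN.eventually_gt_atTop 0, eventually_gt_atTop 0] with N h1 h2 h3 h4 h5 hNpos V _ G hcard hG
  -- A loss of 2β in log-size leaves at least √N vertices in every part.
  set β : ℝ := Real.log N / 4 with hβ
  have hβpos : 0 < β := by positivity
  have hβα : 1 ≤ β / α := by rw [le_div_iff₀ hαpos]; linarith
  set τ : ℕ := ⌊β / α⌋₊ with hτ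
  have hτle : α * τ ≤ β := by
    have := Nat.floor_le (a := β / α) (by positivity)
    rw [le_div_iff₀ hαpos] at this
    linarith
  have hτge : β / (2 * α) ≤ τ := by
    have h6 := Nat.lt_floor_add_one (β / α)
    have h7 : (1 : ℝ) ≤ τ := by
      exact_mod_cast Nat.le_floor (by simpa using hβα)
    have h8 : β / (2 * α) = β / α / 2 := by
      rw [mul_comm 2 α]; exact (div_div β α 2).symm
    rw [h8]
    linarith
  have hbound : ∀ μ : ℝ, 0 < μ → 4 * (2 * Real.log (1 / μ) / (γ * μ)) ≤ Real.log N →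
      Real.log (1 / μ) / (β * γ) ≤ μ / 2 := by
    intro μ hμ h
    rw [div_le_iff₀ (by positivity)]
    have h6 : 2 * Real.log (1 / μ) / (γ * μ) ≤ β := by rw [hβ]; linarith
    rw [div_le_iff₀ (by positivity)] at h6
    linarith
  obtain ⟨s, ⟨hadj, _, _⟩, hsum, hdens, hsize⟩ := exists_completeState (n := n) (by omega) G hγ hβpos hαpos τ
    hτle (by omega) (by rw [hcard]; exact hG) (by
      intro A hApos hAden hAsize hAmax
      have hA2 : ∀ i, 2 ≤ ρ * #(A i) := by
        intro i
        have h6 := hAsize i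
        rw [hcard] at h6
        have h7 : Real.log (2 / ρ) ≤ Real.log #(A i) := by linarith
        have hpos : (0 : ℝ) < #(A i) := by
          refine lt_of_le_of_ne (by positivity) fun h => ?_
          rw [cliqueDens, boxVol, Finset.prod_eq_zero (Finset.mem_univ i) h.symm,
            div_zero] at hAden
          linarith
        have h8 := (Real.log_le_log_iff (by positivity) hpos).1 h7
        rw [div_le_iff₀ hρ] at h8
        linarith
      obtain ⟨i, v, hv, D, hD1, hD2, hD3, hD4, hD5⟩ := exists_step G A (b := β * γ)
        (by positivity) hγ hρ hρ1 hppos hp1 hμ₀ hμ₁ hApos hAden hAmax hA2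
        (fun h => hvertex V G A hA2 h) (hbound μ₀ hμ₀pos h1) (hbound μ₁ hμ₁pos h2)
      refine ⟨i, v, hv, D, hD1, hD2, hD3, hD4, lt_of_lt_of_le ?_ hD5⟩
      have h9 : 3 * Real.log (1 / μ₀) / μ₀ < α :=
        div_lt_div_of_pos_right (by linarith) hμ₀pos
      linarith)
  rw [hcard] at hsize
  have hpigeon : ∃ i, (τ : ℝ) / n ≤ #(s.1 i) := by
    by_contra! h
    have h6 : (∑ i : Fin n, (#(s.1 i) : ℝ)) < ∑ _i : Fin n, (τ : ℝ) / n :=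
      Finset.sum_lt_sum_of_nonempty ⟨⟨0, by omega⟩, Finset.mem_univ _⟩ fun i _ => h i
    rw [Finset.sum_const, Finset.card_univ, Fintype.card_fin, nsmul_eq_mul,
      mul_div_cancel₀ _ hn0.ne', ← Nat.cast_sum, hsum] at h6
    exact lt_irrefl _ h6
  obtain ⟨i, hi⟩ := hpigeon
  refine ⟨i, s.1 i, s.2, le_trans ?_ hi, fun j hj v hv x hx => hadj i j hj.symm v hv x hx,
    fun j => ?_, hdens⟩
  · rw [le_div_iff₀ hn0]
    refine le_trans ?_ hτge
    have hlγpos : 0 < Real.log (1 / γ) := hlog2.trans_le hlγ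
    have h6 : β / (2 * α) = μ₀ * Real.log N / (32 * Real.log (1 / μ₀)) := by
      rw [hβ, hα]; field_simp; norm_num
    have h7 : c / (32 * n * M) * (γ ^ ((2 : ℝ) / n) / Real.log (1 / γ)) * Real.log N * n =
        μ₀ * Real.log N / (32 * (M * Real.log (1 / γ))) := by
      rw [hμ₀c]; field_simp
    rw [h6, h7]
    exact div_le_div_of_nonneg_left (by positivity) (by positivity) (by linarith)
  · have := hsize j
    rw [hβ] at this
    linarith

end Core

/-! ### From a box to a copy count, and from a blowup of K_k to one of K_{k+1}. -/

section Extraction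
open scoped Classical
open Finset Fintype

variable {V : Type*} (G : SimpleGraph V)

theorem cliqueSum_eq_card {ι : Type*} [Fintype ι] [DecidableEq ι] (A : ι → Finset V) :
    cliqueSum G A = #((piFinset A).filter fun w => IsCliqueTuple G w) := by
  rw [cliqueSum, Finset.sum_boole]

/-- Swapping two vertices of K_n gives a second embedding with the same image. The factor 2 makes
the case γ > 1/2 vacuous for N > 0. -/
theorem two_mul_copyCount_le_cliqueSum [Fintype V] {n : ℕ} (hn : 2 ≤ n) :
    2 * (G.copyCount (⊤ : SimpleGraph (Fin n)) : ℝ) ≤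
      cliqueSum G fun _ : Fin n => (Finset.univ : Finset V) := by
  set C : Finset ((⊤ : SimpleGraph (Fin n)).Copy G) := Finset.univ with hC
  have h1 : #C ≤ #((piFinset fun _ : Fin n => (Finset.univ : Finset V)).filter
      fun w => IsCliqueTuple G w) := by
    refine Finset.card_le_card_of_injOn (fun f => ⇑f) ?_ ?_
    · intro f _
      simp only [coe_filter, mem_piFinset, Finset.mem_univ, implies_true, true_and,
        Set.mem_ofPred_eq]
      intro i j hij
      exact f.toHom.map_adj (by simpa using hij)
    · intro f _ g _ h
      exact DFunLike.coe_injective h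
  have h2 : G.copyCount (⊤ : SimpleGraph (Fin n)) =
      #(C.image SimpleGraph.Copy.toSubgraph) :=
    SimpleGraph.copyCount_eq_card_image_copyToSubgraph
  have h3 : #(C.image SimpleGraph.Copy.toSubgraph) * 2 ≤ #C := by
    rw [Finset.card_eq_sum_card_image SimpleGraph.Copy.toSubgraph C, ← smul_eq_mul]
    refine Finset.card_nsmul_le_sum _ _ _ fun S hS => ?_
    obtain ⟨f, _, rfl⟩ := Finset.mem_image.1 hS
    set σ : (⊤ : SimpleGraph (Fin n)) ≃g (⊤ : SimpleGraph (Fin n)) :=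
      ⟨Equiv.swap ⟨0, by omega⟩ ⟨1, by omega⟩, by simp⟩ with hσ
    set g : (⊤ : SimpleGraph (Fin n)).Copy G := f.comp σ.toCopy with hg
    have hgf : g ≠ f := by
      intro h
      have h4 : g ⟨0, by omega⟩ = f ⟨0, by omega⟩ := by rw [h]
      have h5 : g ⟨0, by omega⟩ = f ⟨1, by omega⟩ := by
        simp [hg, hσ]
      have h6 := f.injective (h5.symm.trans h4)
      simp at h6
    have hsub : g.toSubgraph = f.toSubgraph := by
      ext x y
      · simp only [SimpleGraph.Subgraph.map_verts, SimpleGraph.Subgraph.verts_top, Set.image_univ,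
          Set.mem_range]
        constructor
        · rintro ⟨a, rfl⟩; exact ⟨σ a, rfl⟩
        · rintro ⟨a, rfl⟩
          exact ⟨σ.symm a, by simp [hg]⟩
      · simp only [SimpleGraph.Subgraph.map_adj, Relation.Map, SimpleGraph.Subgraph.top_adj]
        constructor
        · rintro ⟨a, b, hab, rfl, rfl⟩
          exact ⟨σ a, σ b, by simpa using hab, rfl, rfl⟩
        · rintro ⟨a, b, hab, rfl, rfl⟩
          exact ⟨σ.symm a, σ.symm b, by simpa using hab, by simp [hg], by simp [hg]⟩
    exact Finset.one_lt_card.2 ⟨g, by simp [hC, hsub], f, by simp [hC], hgf⟩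
  rw [cliqueSum_eq_card, h2]
  exact_mod_cast (by omega)

/-- A clique tuple is determined by its entry in part `i` and the clique tuple formed by the other
entries. -/
theorem cliqueDens_le_cliqueDens_succAbove {k : ℕ} (A : Fin (k + 1) → Finset V)
    (hA : ∀ i, (A i).Nonempty) (i : Fin (k + 1)) :
    cliqueDens G A ≤ cliqueDens G fun j => A (i.succAbove j) := by
  have h1 : cliqueSum G A ≤ #(A i) * cliqueSum G fun j => A (i.succAbove j) := by
    rw [cliqueSum_eq_card, cliqueSum_eq_card, ← Nat.cast_mul, ← card_product]
    refine Nat.cast_le.2 (Finset.card_le_card_of_injOn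
      (fun w => (w i, fun j => w (i.succAbove j))) ?_ ?_)
    · intro w hw
      simp only [coe_filter, mem_piFinset, Set.mem_ofPred_eq, coe_product, Set.mem_prod, mem_coe]
        at hw ⊢
      exact ⟨hw.1 i, fun j => hw.1 _, fun a b hab =>
        hw.2 _ _ fun h => hab (Fin.succAbove_right_injective h)⟩
    · intro w _ w' _ h
      simp only [Prod.mk.injEq] at h
      funext j
      rcases Fin.eq_self_or_eq_succAbove i j with rfl | ⟨l, rfl⟩
      · exact h.1
      · exact congrFun h.2 l
  have h2 : boxVol A = #(A i) * boxVol fun j => A (i.succAbove j) := Fin.prod_univ_succAbove _ i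
  have h3 : (0 : ℝ) < #(A i) := by exact_mod_cast (hA i).card_pos
  have h4 := boxVol_pos fun j => hA (i.succAbove j)
  rw [cliqueDens, cliqueDens, h2, div_le_div_iff₀ (by positivity) h4]
  nlinarith

/-- The `k`-partite graph induced by `G` between disjoint copies of the ranges of the maps
`pos (i, ·)`. -/
def partiteGraph {k s : ℕ} (pos : Fin k × Fin s → V) : SimpleGraph (Fin (k * s)) where
  Adj x y := (finProdFinEquiv.symm x).1 ≠ (finProdFinEquiv.symm y).1 ∧
    G.Adj (pos (finProdFinEquiv.symm x)) (pos (finProdFinEquiv.symm y))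
  symm := ⟨fun _ _ h => ⟨h.1.symm, h.2.symm⟩⟩
  loopless := ⟨fun _ h => h.1 rfl⟩

/-- A tuple can be recovered from the vertex set of its copy, because the classes of `partiteGraph`
are disjoint even where the sets `A j` overlap. -/
theorem cliqueSum_le_copyCount_partiteGraph {k s : ℕ} (hs : 0 < s) (A : Fin k → Finset V)
    (pos : Fin k × Fin s → V) (hpos : ∀ j, ∀ v ∈ A j, ∃ a, pos (j, a) = v) :
    cliqueSum G A ≤ (partiteGraph G pos).copyCount (⊤ : SimpleGraph (Fin k)) := by
  rw [cliqueSum_eq_card, SimpleGraph.copyCount]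
  have : Nonempty (Fin s) := ⟨⟨0, hs⟩⟩
  choose! idx hidx using hpos
  set x : (Fin k → V) → Fin k → Fin (k * s) := fun w j => finProdFinEquiv (j, idx j (w j)) with hx
  have hadj : ∀ w, (∀ j, w j ∈ A j) → IsCliqueTuple G w → ∀ i j, i ≠ j →
      (partiteGraph G pos).Adj (x w i) (x w j) := by
    intro w hw hcl i j hij
    simp only [partiteGraph, hx, Equiv.symm_apply_apply]
    refine ⟨hij, ?_⟩
    rw [hidx i _ (hw i), hidx j _ (hw j)]
    exact hcl i j hij
  have hcopy : ∀ w, (∀ j, w j ∈ A j) → IsCliqueTuple G w →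
      ∃ S : (partiteGraph G pos).Subgraph, Nonempty ((⊤ : SimpleGraph (Fin k)) ≃g S.coe) ∧
        S.verts = Set.range (x w) := by
    intro w hw hcl
    set f : (⊤ : SimpleGraph (Fin k)).Copy (partiteGraph G pos) :=
      ⟨⟨x w, fun {a b} hab => hadj w hw hcl a b (by simpa using hab)⟩, by
        intro a b hab
        by_contra hne
        have := hadj w hw hcl a b hne
        change x w a = x w b at hab
        rw [hab] at this
        exact (partiteGraph G pos).loopless.irrefl _ this⟩ with hf
    refine ⟨f.toSubgraph, ⟨f.isoToSubgraph⟩, ?_⟩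
    simp only [SimpleGraph.Subgraph.map_verts, SimpleGraph.Subgraph.verts_top, Set.image_univ]
    rfl
  choose! S hS1 hS2 using hcopy
  refine Nat.cast_le.2 (Finset.card_le_card_of_injOn S ?_ ?_)
  · intro w hw
    simp only [coe_filter, mem_piFinset, Set.mem_ofPred_eq, Finset.mem_univ, true_and] at hw ⊢
    exact hS1 w hw.1 hw.2
  · intro w hw w' hw' h
    simp only [coe_filter, mem_piFinset, Set.mem_ofPred_eq] at hw hw'
    have h1 : Set.range (x w) = Set.range (x w') := by
      rw [← hS2 w hw.1 hw.2, ← hS2 w' hw'.1 hw'.2, h]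
    funext j
    have h2 : x w j ∈ Set.range (x w') := h1 ▸ Set.mem_range_self j
    obtain ⟨l, hl⟩ := h2
    simp only [hx, EmbeddingLike.apply_eq_iff_eq, Prod.mk.injEq] at hl
    obtain ⟨rfl, hl⟩ := hl
    rw [← hidx l _ (hw.1 l), ← hidx l _ (hw'.1 l), hl]

/-- As `pos` may identify vertices of different parts, injectivity in `G` needs the blowup classes
to follow the parts. A transversal of the blowup uses k different parts, hence all of them, and any
other vertex of a class avoids the k − 1 parts used by the rest. So each class lies in one part,
where `pos` is injective; between classes, adjacency gives distinctness. -/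
theorem graphBlowup_succ_isContained {k s : ℕ} (pos : Fin k × Fin s → V)
    (hinj : ∀ j, Function.Injective fun a => pos (j, a)) (T : Finset V)
    (hT : ∀ v ∈ T, ∀ p, G.Adj v (pos p)) {m t : ℕ} (htm : t ≤ m) (htT : t ≤ #T)
    (h : (graphBlowup (⊤ : SimpleGraph (Fin k)) m).IsContained (partiteGraph G pos)) :
    (graphBlowup (⊤ : SimpleGraph (Fin (k + 1))) t).IsContained G := by
  obtain ⟨φ⟩ := h
  obtain ⟨T', hT', hTc⟩ := Finset.exists_subset_card_eq htT
  set enum : Fin t → V := fun r => (T'.equivFinOfCardEq hTc).symm r with henum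
  have henum_mem : ∀ r, enum r ∈ T := fun r => hT' ((T'.equivFinOfCardEq hTc).symm r).2
  have henum_inj : Function.Injective enum := fun a b hab =>
    (T'.equivFinOfCardEq hTc).symm.injective (Subtype.ext hab)
  set q : Fin k → Fin t → Fin k × Fin s := fun l r =>
    finProdFinEquiv.symm (φ (l, Fin.castLE htm r)) with hq
  have hqadj : ∀ l l' r r', l ≠ l' →
      (q l r).1 ≠ (q l' r').1 ∧ G.Adj (pos (q l r)) (pos (q l' r')) := by
    intro l l' r r' hl
    exact φ.toHom.map_adj (show (⊤ : SimpleGraph (Fin k)).Adj l l' by simpa using hl)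
  have hqpart : ∀ l r r', (q l r').1 = (q l r).1 := by
    intro l r r'
    have hinj' : Function.Injective fun l => (q l r).1 := by
      intro a b hab
      by_contra hne
      exact (hqadj a b r r hne).1 hab
    obtain ⟨l', hl'⟩ := (Finite.injective_iff_surjective.1 hinj') (q l r').1
    by_cases hll : l' = l
    · rw [← hl', hll]
    · exact absurd hl' (hqadj l' l r r' hll).1
  have hqinj : ∀ l, Function.Injective fun r => pos (q l r) := by
    intro l a b hab
    have h1 := hqpart l a b
    have h2 : (q l a).2 = (q l b).2 := by
      refine hinj (q l a).1 ?_
      change pos ((q l a).1, (q l a).2) = pos ((q l a).1, (q l b).2)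
      rw [← h1, Prod.mk.eta, h1, Prod.mk.eta]
      exact hab
    have h3 : q l a = q l b := Prod.ext h1.symm h2
    have h4 := φ.injective (finProdFinEquiv.symm.injective h3)
    simpa using h4
  set ψ : Fin (k + 1) × Fin t → V := fun p =>
    Fin.cases (motive := fun _ => Fin t → V) enum (fun l r => pos (q l r)) p.1 p.2 with hψ
  have hψadj : ∀ l l' r r', l ≠ l' → G.Adj (ψ (l, r)) (ψ (l', r')) := by
    intro l l' r r' hl
    induction l using Fin.cases with
    | zero =>
      induction l' using Fin.cases with
      | zero => exact absurd rfl hl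
      | succ l' => exact hT _ (henum_mem r) _
    | succ l =>
      induction l' using Fin.cases with
      | zero => exact (hT _ (henum_mem r') _).symm
      | succ l' => exact (hqadj l l' r r' fun h => hl (by rw [h])).2
  have hψinj : Function.Injective ψ := by
    rintro ⟨l, r⟩ ⟨l', r'⟩ hab
    by_cases hl : l = l'
    · subst hl
      induction l using Fin.cases with
      | zero => rw [henum_inj (show enum r = enum r' from hab)]
      | succ l => rw [hqinj l (show pos (q l r) = pos (q l r') from hab)]
    · have := hψadj l l' r r' hl
      rw [hab] at this
      exact absurd this (G.loopless.irrefl _)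
  refine ⟨⟨⟨ψ, fun {a b} hab => ?_⟩, hψinj⟩⟩
  have hab' : (⊤ : SimpleGraph (Fin (k + 1))).Adj a.1 b.1 := hab
  exact hψadj a.1 b.1 a.2 b.2 (by simpa using hab')

end Extraction

/-! ### Passing to the constants. -/

section Final
open Finset

/-- Small N are free: setting `ε N = c` there, the empty blowup with t = 0 suffices. -/
theorem forcesBlowup_of_eventually {V : Type*} [Fintype V] (H : SimpleGraph V) {γ c : ℝ}
    (h : ∀ᶠ N : ℕ in atTop, ∀ G : SimpleGraph (Fin N),
      γ * (N : ℝ) ^ Fintype.card V ≤ (G.copyCount H : ℝ) →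
        ∃ t : ℕ, c * Real.logb 2 N ≤ t ∧ (graphBlowup H t).IsContained G) :
    ForcesBlowup H γ c := by
  obtain ⟨N0, hN0⟩ := eventually_atTop.1 h
  refine ⟨fun N => if N < N0 then c else 0, ?_, fun N G hG => ?_⟩
  · refine tendsto_const_nhds.congr' ?_
    filter_upwards [eventually_ge_atTop N0] with N hN
    simp [not_lt.2 hN]
  · by_cases hN : N < N0
    · exact ⟨0, by simp [hN], .of_isEmpty⟩
    · simp only [hN, if_false, sub_zero]
      exact hN0 N (not_lt.1 hN) G hG

theorem forcesBlowup_of_half_lt {k : ℕ} (hk : 2 ≤ k) {γ c : ℝ} (hγ : 1 / 2 < γ) :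
    ForcesBlowup (⊤ : SimpleGraph (Fin k)) γ c := by
  refine forcesBlowup_of_eventually _ ?_
  filter_upwards [eventually_gt_atTop 0] with N hN G hG
  exfalso
  have h1 := two_mul_copyCount_le_cliqueSum G hk
  have h2 := cliqueSum_le_boxVol G fun _ : Fin k => (Finset.univ : Finset (Fin N))
  have h3 : boxVol (fun _ : Fin k => (Finset.univ : Finset (Fin N))) = (N : ℝ) ^ k := by
    simp [boxVol]
  have h4 : (0 : ℝ) < (N : ℝ) ^ k := by positivity
  rw [Fintype.card_fin] at hG
  rw [h3] at h2
  nlinarith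

theorem exists_forcesBlowup_succ {k : ℕ} (hk : 1 ≤ k) :
    ∃ δ : ℝ, 0 < δ ∧ ∀ γ : ℝ, 0 < γ → γ ≤ 1 / 2 → ∀ c c₀ : ℝ, 0 < c →
      c ≤ δ * (γ ^ ((2 : ℝ) / ((k : ℝ) + 1)) / Real.logb 2 (1 / γ)) → 8 * c ≤ c₀ →
      ForcesBlowup (⊤ : SimpleGraph (Fin k)) (γ / (8 * (k : ℝ) ^ k)) c₀ →
      ForcesBlowup (⊤ : SimpleGraph (Fin (k + 1))) γ c := by
  obtain ⟨δ, hδ, hcore⟩ := exists_complete_to_box.{0} (n := k + 1) (by omega)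
  refine ⟨δ, hδ, fun γ hγ hγ1 c c₀ hc hcδ hcc₀ hforce => forcesBlowup_of_eventually _ ?_⟩
  obtain ⟨ε, hε, hblow⟩ := hforce
  have hc₀ : 0 < c₀ := by linarith
  obtain ⟨M0, hM0⟩ := eventually_atTop.1 (hε.eventually_le_const (show 0 < c₀ / 2 by positivity))
  have hlogN : Tendsto (fun N : ℕ => Real.log N) atTop atTop :=
    Real.tendsto_log_atTop.comp tendsto_natCast_atTop_atTop
  have hlog2 : 0 < Real.log 2 := Real.log_pos (by norm_num)
  filter_upwards [hcore γ hγ hγ1, hlogN.eventually_ge_atTop (2 * Real.log (M0 + 1)),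
    hlogN.eventually_gt_atTop 0] with N hN hNM hNpos G hG
  have hcl := two_mul_copyCount_le_cliqueSum G (n := k + 1) (by omega)
  rw [Fintype.card_fin] at hG
  have hcc0 : (0 : ℝ) ≤ G.copyCount (⊤ : SimpleGraph (Fin (k + 1))) := Nat.cast_nonneg _
  obtain ⟨i, T, A, hTcard, hTadj, hAsize, hAden⟩ := hN (Fin N) G (Fintype.card_fin N) (by linarith)
  have hApos : ∀ j, 0 < #(A j) := fun j => by
    refine Nat.pos_of_ne_zero fun h => ?_
    have := hAsize j
    rw [h, Nat.cast_zero, Real.log_zero] at this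
    linarith
  have hAne : ∀ j, (A j).Nonempty := fun j => card_pos.1 (hApos j)
  obtain ⟨j0, _, hj0⟩ := Finset.univ.exists_min_image (fun j => #(A j)) ⟨i, Finset.mem_univ i⟩
  set s := #(A j0) with hs
  have hspos : 0 < s := hApos j0
  obtain ⟨D, hDsub, hDcard, hDden⟩ := exists_subbox_le_cliqueDens G (fun j => A (i.succAbove j))
    (fun _ => s) (fun _ => hspos) (fun j => hj0 _ (Finset.mem_univ _))
  set pos : Fin k × Fin s → Fin N := fun p => ((D p.1).equivFinOfCardEq (hDcard p.1)).symm p.2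
    with hpos
  have hposD : ∀ p, pos p ∈ D p.1 := fun p => (((D p.1).equivFinOfCardEq (hDcard p.1)).symm p.2).2
  have hpossurj : ∀ j, ∀ v ∈ D j, ∃ a, pos (j, a) = v := fun j v hv =>
    ⟨(D j).equivFinOfCardEq (hDcard j) ⟨v, hv⟩, by simp [hpos]⟩
  have hposinj : ∀ j, Function.Injective fun a => pos (j, a) := fun j a b hab =>
    ((D j).equivFinOfCardEq (hDcard j)).symm.injective (Subtype.ext hab)
  have hcount := cliqueSum_le_copyCount_partiteGraph G hspos D pos hpossurj
  have hDvol : boxVol D = (s : ℝ) ^ k := by simp [boxVol, hDcard]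
  have hsR : (0 : ℝ) < s := by exact_mod_cast hspos
  have hkR : (0 : ℝ) < k := by exact_mod_cast hk
  have hDsum : γ / 2 * (s : ℝ) ^ k ≤ cliqueSum G D := by
    have h1 := (hAden.trans (cliqueDens_le_cliqueDens_succAbove G A hAne i)).trans hDden
    rwa [cliqueDens, hDvol, le_div_iff₀ (by positivity)] at h1
  -- The count (γ/2) s^k equals (γ/(2k^k)) (ks)^k, more than the hypothesis requires.
  obtain ⟨m, hm, hcont⟩ := hblow (k * s) (partiteGraph G pos) (by
    rw [Fintype.card_fin]
    refine le_trans ?_ (hDsum.trans hcount)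
    push_cast
    rw [mul_pow, div_mul_eq_mul_div, div_le_iff₀ (by positivity)]
    have : 0 < γ * ((k : ℝ) ^ k * (s : ℝ) ^ k) := by positivity
    linarith)
  have hsize : M0 ≤ k * s := by
    have h1 : Real.log (M0 + 1) ≤ Real.log s := by
      have := hAsize j0
      linarith
    have h2 := (Real.log_le_log_iff (by positivity) hsR).1 h1
    have h3 : M0 + 1 ≤ s := by exact_mod_cast h2
    nlinarith
  have hlogM : Real.log N / 2 ≤ Real.log ((k * s : ℕ) : ℝ) :=
    (hAsize j0).trans (Real.log_le_log hsR (by exact_mod_cast Nat.le_mul_of_pos_left s hk))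
  have hNb : 0 < Real.logb 2 N := div_pos hNpos hlog2
  have hcm : c * Real.logb 2 N ≤ m := by
    refine le_trans ?_ hm
    have h1 : Real.logb 2 N / 2 ≤ Real.logb 2 ((k * s : ℕ) : ℝ) := by
      rw [Real.logb, Real.logb, div_right_comm]
      exact div_le_div_of_nonneg_right hlogM hlog2.le
    have h2 : c₀ / 2 ≤ c₀ - ε (k * s) := by linarith [hM0 _ hsize]
    -- One factor 2 is lost to the error term and one to parts of size only √N; `8 * c ≤ c₀` leaves
    -- room to spare.
    calc c * Real.logb 2 N ≤ c₀ / 2 * (Real.logb 2 N / 2) := by nlinarith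
      _ ≤ (c₀ - ε (k * s)) * Real.logb 2 ((k * s : ℕ) : ℝ) :=
        mul_le_mul h2 h1 (by positivity) (by linarith)
  have hcT : c * Real.logb 2 N ≤ #T := by
    refine le_trans ?_ hTcard
    refine (mul_le_mul_of_nonneg_right hcδ hNb.le).trans (le_of_eq ?_)
    have hlγ : Real.log (1 / γ) ≠ 0 := (Real.log_pos (by rw [lt_div_iff₀ hγ]; linarith)).ne'
    rw [Real.logb, Real.logb]
    push_cast
    field_simp
  refine ⟨⌈c * Real.logb 2 N⌉₊, Nat.le_ceil _, ?_⟩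
  exact graphBlowup_succ_isContained G pos hposinj T
    (fun v hv p => hTadj _ (Fin.succAbove_ne i p.1) v hv _ (hDsub _ (hposD p)))
    (Nat.ceil_le.2 hcm) (Nat.ceil_le.2 hcT) hcont

end Final

theorem theorem5p3 (k : ℕ) (hk : 3 ≤ k) :
    ∃ δ : ℝ, 0 < δ ∧ ∀ γ : ℝ, 0 < γ → γ < 1 →
      min (ENNReal.ofReal (δ * (γ ^ ((2 : ℝ) / ((k : ℝ) + 1)) / Real.logb 2 (1 / γ))))
          (1 / 8 * blowupConst (⊤ : SimpleGraph (Fin k)) (γ / (8 * (k : ℝ) ^ k)))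
        ≤ blowupConst (⊤ : SimpleGraph (Fin (k + 1))) γ := by
  obtain ⟨δ, hδ, hmain⟩ := exists_forcesBlowup_succ (k := k) (by omega)
  refine ⟨δ, hδ, fun γ hγ hγ1 => le_of_forall_lt fun x hx => ?_⟩
  -- The intermediate point is finite and positive, so it serves as a real constant; being strictly
  -- below the minimum, it leaves room for an admissible `c₀` above `8 * x'`.
  obtain ⟨x', hxx', hx'⟩ := exists_between hx
  have hxtop : x' ≠ ⊤ := hx'.ne_top
  have hpos : 0 < x'.toReal := ENNReal.toReal_pos (bot_lt_of_lt hxx').ne' hxtop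
  have hofReal : ENNReal.ofReal x'.toReal = x' := ENNReal.ofReal_toReal hxtop
  refine hxx'.trans_le ?_
  suffices h : ForcesBlowup (⊤ : SimpleGraph (Fin (k + 1))) γ x'.toReal by
    rw [← hofReal]
    exact le_iSup₂ (f := fun (c : ℝ) (_ : 0 < c ∧ ForcesBlowup (⊤ : SimpleGraph (Fin (k + 1))) γ c)
      => ENNReal.ofReal c) x'.toReal ⟨hpos, h⟩
  rcases lt_or_ge (1 / 2) γ with hγ2 | hγ2
  · exact forcesBlowup_of_half_lt (by omega) hγ2
  obtain ⟨h1, h2⟩ := lt_min_iff.1 hx'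
  have h3 : 8 * x' < blowupConst (⊤ : SimpleGraph (Fin k)) (γ / (8 * (k : ℝ) ^ k)) := by
    rw [one_div, mul_comm, ← div_eq_mul_inv] at h2
    have := ENNReal.mul_lt_of_lt_div h2
    rwa [mul_comm]
  obtain ⟨c₀, hc₀⟩ := lt_iSup_iff.1 h3
  obtain ⟨⟨hc₀pos, hforce⟩, hlt⟩ := lt_iSup_iff.1 hc₀
  refine hmain γ hγ hγ2 x'.toReal c₀ hpos ?_ ?_ hforce
  · exact (ENNReal.lt_ofReal_iff_toReal_lt hxtop).1 h1 |>.le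
  · have h4 := (ENNReal.lt_ofReal_iff_toReal_lt hlt.ne_top).1 hlt
    rw [ENNReal.toReal_mul] at h4
    simpa using h4.le
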